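/- Let $(M,g)$ be a smooth Riemannian manifold without boundary, of dimension $n$, with Levi-Civita connection $\nabla$. Let $C^\infty(S^r)$ be the space of smooth symmetric covariant tensor fields of rank $r$ on $M$ (real- or complex-valued), with $S^{-1}=0$, and let $\sigma$ denote symmetrization. Define - the inner differentiation $d=\sigma\nabla:C^\infty(S^r)\to C^\infty(S^{r+1})$; - the divergence $\delta:C^\infty(S^{r})\to C^\infty(S^{r-1})$, $(\delta f)_{i_1\dots i_{r-1}}=g^{pq}\nabla_p f_{q i_1\dots i_{r-1}}$ (with $\delta=0$ on $S^0$); - the symmetric multiplication by the metric $i:S^r\to S^{r+2}$, $if=\sigma(f\otimes g)$, and the trace $j:S^{r}\to S^{r-2}$, $(jf)_{i_1\dots i_{r-2}}=g^{pq}f_{pq i_1\dots i_{r-2}}$ (with $j=0$ on $S^0$ and $S^1$). A field $f\in C^\infty(S^r)$ is a Killing tensor field if $df=0$, and a potential tensor field if $f=dv$ for some $v\in C^\infty(S^{r-1})$ (so a potential field of rank $0$ is the zero function). Let $\varepsilon\in\{0,1\}$, let $m\ge 0$ be an integer, and let $f\in C^\infty(S^{2m+\varepsilon})$ be a Killing tensor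 field. Then $f$ admits a representation $$f=\sum_{k=0}^m i^{\,m-k}f^k,\qquad f^k\in C^\infty(S^{2k+\varepsilon}),\quad jf^k=0,$$ and in every such representation the divergence $\delta f^k$ is a potential tensor field for every $k=0,\dots,m$. -/

import Mathlib

open scoped Manifold ContDiff

noncomputable section

namespace KillingTensor

/-! ### Multilinear algebra on one vector space -/

section Algebra

variable {𝕜 : Type*} [RCLike 𝕜] {V : Type*} [AddCommGroup V] [Module ℝ V]

/-- The symmetrization `σ`, i.e. the average over all permutations of the arguments. -/
def symmetrize {N : ℕ} (T : MultilinearMap ℝ (fun _ : Fin N => V) 𝕜) :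
    MultilinearMap ℝ (fun _ : Fin N => V) 𝕜 :=
  ((N.factorial : ℝ)⁻¹) • ∑ π : Equiv.Perm (Fin N), T.domDomCongr π

/-- The tensor product `T ⊗ B` of a rank `N` covariant tensor `T` and a bilinear form `B`. -/
def tensorBilin {N : ℕ} (T : MultilinearMap ℝ (fun _ : Fin N => V) 𝕜) (B : V →ₗ[ℝ] V →ₗ[ℝ] ℝ) :
    MultilinearMap ℝ (fun _ : Fin (N + 2) => V) 𝕜 :=
  MultilinearMap.mk'
    (fun w => B (w (Fin.natAdd N 0)) (w (Fin.natAdd N 1)) • T (fun i => w (Fin.castAdd 2 i)))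
    (by
      intro w i u v
      induction i using Fin.addCases with
      | left i =>
        have h : ∀ z : V, (fun j : Fin N => Function.update w (Fin.castAdd 2 i) z (Fin.castAdd 2 j)) =
            Function.update (fun j => w (Fin.castAdd 2 j)) i z := by
          intro z; ext j
          simp [Function.update_apply]
        have h0 : ∀ (z : V) (l : Fin 2), Function.update w (Fin.castAdd 2 i) z (Fin.natAdd N l) =
            w (Fin.natAdd N l) := by
          intro z l
          rw [Function.update_of_ne]
          intro hh
          have := congrArg Fin.val hh
          simp at this; omega
        simp only [h, h0, MultilinearMap.map_update_add, smul_add]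
      | right i =>
        have h : ∀ z : V, (fun j : Fin N => Function.update w (Fin.natAdd N i) z (Fin.castAdd 2 j)) =
            fun j => w (Fin.castAdd 2 j) := by
          intro z; ext j
          rw [Function.update_of_ne]
          intro hh
          have := congrArg Fin.val hh
          simp at this; omega
        simp only [h]
        fin_cases i <;> simp [add_smul])
    (by
      intro w i c u
      induction i using Fin.addCases with
      | left i =>
        have h : ∀ z : V, (fun j : Fin N => Function.update w (Fin.castAdd 2 i) z (Fin.castAdd 2 j)) =
            Function.update (fun j => w (Fin.castAdd 2 j)) i z := by
          intro z; ext j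
          simp [Function.update_apply]
        have h0 : ∀ (z : V) (l : Fin 2), Function.update w (Fin.castAdd 2 i) z (Fin.natAdd N l) =
            w (Fin.natAdd N l) := by
          intro z l
          rw [Function.update_of_ne]
          intro hh
          have := congrArg Fin.val hh
          simp at this; omega
        simp only [h, h0, MultilinearMap.map_update_smul]
        rw [smul_comm]
      | right i =>
        have h : ∀ z : V, (fun j : Fin N => Function.update w (Fin.natAdd N i) z (Fin.castAdd 2 j)) =
            fun j => w (Fin.castAdd 2 j) := by
          intro z; ext j
          rw [Function.update_of_ne]
          intro hh
          have := congrArg Fin.val hh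
          simp at this; omega
        simp only [h]
        fin_cases i <;> simp [mul_smul])

/-- The covariant tensor on `ℝⁿ` with components `c_{a_1 … a_N}` in the standard basis:
`w ↦ ∑ c_{a_1 … a_N} w_1^{a_1} ⋯ w_N^{a_N}`. -/
def ofComponents {n N : ℕ} (c : (Fin N → Fin n) → 𝕜) :
    MultilinearMap ℝ (fun _ : Fin N => EuclideanSpace ℝ (Fin n)) 𝕜 :=
  ∑ a : Fin N → Fin n,
    ((MultilinearMap.mkPiAlgebra ℝ (Fin N) ℝ).compLinearMap
      (fun j => (EuclideanSpace.proj (a j) : EuclideanSpace ℝ (Fin n) →L[ℝ] ℝ).toLinearMap)).smulRight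
        (c a)

end Algebra

/-! ### Tensor fields on a manifold -/

variable (𝕜 : Type*) [RCLike 𝕜] (n : ℕ) (M : Type*) [TopologicalSpace M]
  [ChartedSpace (EuclideanSpace ℝ (Fin n)) M]

/-- Covariant tensor fields of rank `N` on `M` with real or complex values (not necessarily
symmetric or smooth). -/
abbrev TensorField (N : ℕ) : Type _ :=
  ∀ x : M, MultilinearMap ℝ (fun _ : Fin N => TangentSpace (𝓡 n) x) 𝕜

variable {n M}

/-- The coordinate vector `∂/∂x^p` of the chart around `c`, at the point with coordinates `y`. -/
def coordVec (c : M) (y : EuclideanSpace ℝ (Fin n)) (p : Fin n) :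
    TangentSpace (𝓡 n) ((extChartAt (𝓡 n) c).symm y) :=
  mfderiv 𝓘(ℝ, EuclideanSpace ℝ (Fin n)) (𝓡 n) (extChartAt (𝓡 n) c).symm y
    (EuclideanSpace.single p (1 : ℝ) : EuclideanSpace ℝ (Fin n))

/-- The partial derivative `∂F/∂x^p` of a function of the coordinates. -/
def partialDeriv {W : Type*} [NormedAddCommGroup W] [NormedSpace ℝ W]
    (F : EuclideanSpace ℝ (Fin n) → W) (y : EuclideanSpace ℝ (Fin n)) (p : Fin n) : W :=
  fderiv ℝ F y (EuclideanSpace.single p (1 : ℝ))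

variable {𝕜}

/-- The components `f_{a_1 … a_N}` of a tensor field in the chart around `c`. -/
def components {N : ℕ} (f : TensorField 𝕜 n M N) (c : M) (y : EuclideanSpace ℝ (Fin n))
    (a : Fin N → Fin n) : 𝕜 :=
  f ((extChartAt (𝓡 n) c).symm y) (fun j => coordVec c y (a j))

/-- `f ∈ C^∞(S^N)`: `f` is symmetric and all its components in charts are smooth. -/
structure IsSmoothSymmetric {N : ℕ} (f : TensorField 𝕜 n M N) : Prop where
  symm : ∀ (x : M) (π : Equiv.Perm (Fin N)), (f x).domDomCongr π = f x
  smooth : ∀ (c : M) (a : Fin N → Fin n),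
    ContDiffOn ℝ ∞ (fun y => components f c y a) (extChartAt (𝓡 n) c).target

/-- Renaming the rank of a tensor field along an equality. -/
def castRank {N N' : ℕ} (h : N = N') (f : TensorField 𝕜 n M N) : TensorField 𝕜 n M N' :=
  fun x => (f x).domDomCongr (finCongr h)

variable [IsManifold (𝓡 n) ∞ M]
  (g : Bundle.ContMDiffRiemannianMetric (𝓡 n) ∞ (EuclideanSpace ℝ (Fin n))
    (fun x : M => TangentSpace (𝓡 n) x))

/-- The metric at `x` as a bilinear form on `T_xM`. -/
def metricForm (x : M) : TangentSpace (𝓡 n) x →ₗ[ℝ] TangentSpace (𝓡 n) x →ₗ[ℝ] ℝ :=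
  LinearMap.mk₂ ℝ (fun u v => g.inner x u v) (by simp) (by simp) (by simp) (by simp)

/-- The components `g_{pq}` of the metric in the chart around `c`. -/
def metricMatrix (c : M) (y : EuclideanSpace ℝ (Fin n)) : Matrix (Fin n) (Fin n) ℝ :=
  Matrix.of fun p q => metricForm g ((extChartAt (𝓡 n) c).symm y) (coordVec c y p) (coordVec c y q)

/-- The Christoffel symbols `Γ^q_{pr}` of the Levi-Civita connection in the chart around `c`. -/
def christoffel (c : M) (y : EuclideanSpace ℝ (Fin n)) (q p r : Fin n) : ℝ :=
  (1 / 2 : ℝ) * ∑ l : Fin n, (metricMatrix g c y)⁻¹ q l *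
    (partialDeriv (fun z => metricMatrix g c z r l) y p
      + partialDeriv (fun z => metricMatrix g c z p l) y r
      - partialDeriv (fun z => metricMatrix g c z p r) y l)

/-- The components of the covariant derivative in the chart around `c`:
`∇_p f_{a_1 … a_N} = ∂_p f_{a_1 … a_N} - ∑_k ∑_q Γ^q_{p a_k} f_{a_1 … q … a_N}`. -/
def covDerivComponents {N : ℕ} (f : TensorField 𝕜 n M N) (c : M) (y : EuclideanSpace ℝ (Fin n))
    (p : Fin n) (a : Fin N → Fin n) : 𝕜 :=
  partialDeriv (fun z => components f c z a) y p
    - ∑ k : Fin N, ∑ q : Fin n,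
        christoffel g c y q p (a k) • components f c y (Function.update a k q)

/-- The covariant derivative `∇f` of rank `N + 1`; the first argument is the direction of
differentiation. At the point `x` it is computed in the preferred chart around `x`; the coordinate
vectors of this chart at `x` are the standard basis of `T_xM = ℝⁿ`. -/
def covDeriv {N : ℕ} (f : TensorField 𝕜 n M N) : TensorField 𝕜 n M (N + 1) := fun x =>
  (ofComponents fun a : Fin (N + 1) → Fin n =>
    covDerivComponents g f x (extChartAt (𝓡 n) x x) (a 0) (fun j => a j.succ) :
    MultilinearMap ℝ (fun _ : Fin (N + 1) => EuclideanSpace ℝ (Fin n)) 𝕜)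

/-- The inner differentiation `d = σ∇ : C^∞(S^N) → C^∞(S^{N+1})`. -/
def innerDiff {N : ℕ} (f : TensorField 𝕜 n M N) : TensorField 𝕜 n M (N + 1) :=
  fun x => symmetrize (covDeriv g f x)

/-- The standard basis vector of `T_xM = ℝⁿ`. -/
def tangentBasis (x : M) (p : Fin n) : TangentSpace (𝓡 n) x :=
  (EuclideanSpace.single p (1 : ℝ) : EuclideanSpace ℝ (Fin n))

/-- The Gram matrix `g_{pq}` of the metric at `x` in the standard basis of `T_xM = ℝⁿ`. -/
def gram (x : M) : Matrix (Fin n) (Fin n) ℝ :=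
  Matrix.of fun p q => metricForm g x (tangentBasis x p) (tangentBasis x q)

/-- The contraction of the first two arguments with the metric,
`(jf)_{a_1 … a_N} = g^{pq} f_{p q a_1 … a_N}`. -/
def trace {N : ℕ} (f : TensorField 𝕜 n M (N + 2)) : TensorField 𝕜 n M N := fun x =>
  ∑ p : Fin n, ∑ q : Fin n,
    (gram g x)⁻¹ p q • ((f x).curryLeft (tangentBasis x p)).curryLeft (tangentBasis x q)

/-- The divergence `(δf)_{a_1 … a_N} = g^{pq} ∇_p f_{q a_1 … a_N}`, with `δ = 0` in rank `0`. -/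
def divergence : {N : ℕ} → TensorField 𝕜 n M N → TensorField 𝕜 n M (N - 1)
  | 0, _ => 0
  | _ + 1, f => trace g (covDeriv g f)

/-- `jf = 0`, which is no condition for tensors of rank `0` and `1`. -/
def IsTraceFree : {N : ℕ} → TensorField 𝕜 n M N → Prop
  | 0, _ => True
  | 1, _ => True
  | _ + 2, f => trace g f = 0

/-- The symmetric multiplication by the metric, `if = σ(f ⊗ g)`. -/
def mulMetric {N : ℕ} (f : TensorField 𝕜 n M N) : TensorField 𝕜 n M (N + 2) :=
  fun x => symmetrize (tensorBilin (f x) (metricForm g x))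

/-- The iterate `i^s` of the symmetric multiplication by the metric. -/
def mulMetricPow {N : ℕ} (f : TensorField 𝕜 n M N) : (s : ℕ) → TensorField 𝕜 n M (N + 2 * s)
  | 0 => f
  | s + 1 => mulMetric g (mulMetricPow f s)

/-- `f` is a Killing tensor field: `f ∈ C^∞(S^N)` and `df = 0`. -/
structure IsKilling {N : ℕ} (f : TensorField 𝕜 n M N) : Prop where
  smoothSymmetric : IsSmoothSymmetric f
  innerDiff_eq_zero : innerDiff g f = 0

/-- `f` is a potential tensor field: `f = dv` for some `v ∈ C^∞(S^{N-1})`. As `S^{-1} = 0`,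
a potential field of rank `0` is the zero function. -/
def IsPotential : {N : ℕ} → TensorField 𝕜 n M N → Prop
  | 0, f => f = 0
  | N + 1, f => ∃ v : TensorField 𝕜 n M N, IsSmoothSymmetric v ∧ f = innerDiff g v

/-- `f = ∑_{k=0}^m i^{m-k} f^k` with `f^k ∈ C^∞(Ker^{ε+2k} j)`, for a field `f` of rank `ε + 2m`;
here `ε ∈ {0, 1}` is the parity of the rank. -/
structure IsHarmonicExpansion {ε m : ℕ} (f : TensorField 𝕜 n M (ε + 2 * m))
    (h : ∀ k : Fin (m + 1), TensorField 𝕜 n M (ε + 2 * (k : ℕ))) : Prop where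
  smoothSymmetric : ∀ k, IsSmoothSymmetric (h k)
  traceFree : ∀ k, IsTraceFree g (h k)
  eq_sum : f = ∑ k : Fin (m + 1),
    castRank (by have := k.isLt; omega) (mulMetricPow g (h k) (m - (k : ℕ)))

end KillingTensor

end

/-!
At each point `x` a symmetric tensor `f` is the same as the homogeneous polynomial
`w ↦ f(w, …, w)` on `T_xM`. In these terms `i` is multiplication by the quadratic form `Q` of the
metric, `j` is a multiple of the Laplacian `Δ`, and `d` is `∑ X_p ∇_p`. Since `∇` is compatible with
the metric, `∇_p` commutes with `Q` and `Δ`. The representation of `f` is therefore the classical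
expansion of a polynomial in powers of `Q` with harmonic coefficients; it exists because dividing
the coefficients of the expansion of `Δf` by positive weights gives a `w` with `Δ(Qw) = Δf`.

If `f^k` is trace-free, then `d f^k` is biharmonic, `δ f^k` is a multiple of `Δ (d f^k)`, and
`d f^k - Q u_k` is harmonic for a suitable multiple `u_k` of `Δ (d f^k)`. Inserting this into
`df = ∑ Q^{m-k} d f^k = 0`, the uniqueness of harmonic expansions gives `u_0 = 0` and
`u_{k+1} = Q u_k - d f^k`. Hence `u_{k+1} = -∑_{j ≤ k} Q^{k-j} d f^j`, and as `d` commutes with `i`,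
`δ f^{k+1}` is a multiple of `d` applied to the partial sum `∑_{j ≤ k} i^{k-j} f^j`.
-/

noncomputable section

namespace KillingTensor

section SymmetricArrays

variable {ι A : Type*} {N : ℕ}

/-- A family of components `c_{a_1 … a_N}` which is invariant under permutations of the indices. -/
def IsSymmArray (c : (Fin N → ι) → A) : Prop :=
  ∀ (π : Equiv.Perm (Fin N)) (a : Fin N → ι), c (a ∘ π) = c a

theorem IsSymmArray.cons {c : (Fin (N + 1) → ι) → A} (hc : IsSymmArray c) (p : ι) :
    IsSymmArray fun a => c (Fin.cons p a) := by
  intro π a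
  change c (Fin.cons p (a ∘ π)) = c (Fin.cons p a)
  rw [← hc (Equiv.Perm.decomposeFin.symm (0, π)) (Fin.cons p a)]
  congr 1
  ext j
  refine Fin.cases ?_ (fun j => ?_) j <;> simp

theorem IsSymmArray.swap {c : (Fin (N + 2) → ι) → A} (hc : IsSymmArray c) (p q : ι)
    (a : Fin N → ι) : c (Fin.cons p (Fin.cons q a)) = c (Fin.cons q (Fin.cons p a)) := by
  rw [← hc (Equiv.swap 0 (Fin.succ 0)) (Fin.cons p (Fin.cons q a))]
  congr 1
  ext j
  refine Fin.cases ?_ (Fin.cases ?_ fun j => ?_) j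
  · simp only [Function.comp_apply, Equiv.swap_apply_left]
    rfl
  · simp only [Function.comp_apply, Equiv.swap_apply_right]
    rfl
  · rw [Function.comp_apply, Equiv.swap_apply_of_ne_of_ne (Fin.succ_ne_zero _)
      ((Fin.succ_injective _).ne (Fin.succ_ne_zero _))]
    rfl

end SymmetricArrays

section Polynomials

open MvPolynomial

variable {ι : Type*} [Fintype ι] {A : Type*} [CommRing A] {N : ℕ}

/-- The homogeneous polynomial `∑ c_{a_1 … a_N} X_{a_1} ⋯ X_{a_N}` of an array of components. -/
def toPoly : ((Fin N → ι) → A) →ₗ[A] MvPolynomial ι A where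
  toFun c := ∑ a, c a • ∏ j, X (a j)
  map_add' c c' := by simp only [Pi.add_apply, add_smul, Finset.sum_add_distrib]
  map_smul' r c := by simp only [Pi.smul_apply, smul_assoc, Finset.smul_sum, RingHom.id_apply]

theorem toPoly_apply (c : (Fin N → ι) → A) : toPoly c = ∑ a, c a • ∏ j, X (a j) := rfl

theorem toPoly_isHomogeneous (c : (Fin N → ι) → A) : (toPoly c).IsHomogeneous N := by
  refine IsHomogeneous.sum _ _ _ fun a _ => (homogeneousSubmodule ι A N).smul_mem _ ?_
  simpa using IsHomogeneous.prod Finset.univ (fun j => (X (a j) : MvPolynomial ι A))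
    (fun _ => 1) fun j _ => isHomogeneous_X _ _

theorem toPoly_comp_perm (c : (Fin N → ι) → A) (π : Equiv.Perm (Fin N)) :
    toPoly (fun a => c (a ∘ π)) = toPoly c := by
  simp only [toPoly_apply]
  refine Fintype.sum_equiv (Equiv.arrowCongr π.symm (Equiv.refl _)) _ _ fun a => ?_
  congr 1
  simpa using (Equiv.prod_comp π fun j => (X (a j) : MvPolynomial ι A)).symm

theorem toPoly_rank_zero (c : (Fin 0 → ι) → A) : toPoly c = C (c default) := by
  simp [toPoly_apply, smul_eq_C_mul]

theorem toPoly_cons (c : (Fin (N + 1) → ι) → A) :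
    toPoly c = ∑ p, X p * toPoly (fun a => c (Fin.cons p a)) := by
  simp only [toPoly_apply]
  rw [← (Fin.consEquiv fun _ => ι).sum_comp, Fintype.sum_prod_type]
  refine Finset.sum_congr rfl fun p _ => ?_
  rw [Finset.mul_sum]
  refine Finset.sum_congr rfl fun a _ => ?_
  simp only [Fin.consEquiv, Equiv.coe_fn_mk, Fin.prod_univ_succ, Fin.cons_zero, Fin.cons_succ,
    mul_smul_comm]

theorem pderiv_toPoly {c : (Fin (N + 1) → ι) → A} (hc : IsSymmArray c) (p : ι) :
    pderiv p (toPoly c) = (N + 1) • toPoly (fun a => c (Fin.cons p a)) := by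
  classical
  induction N with
  | zero =>
    rw [toPoly_cons, map_sum]
    simp [toPoly_rank_zero, pderiv_X, Pi.single_apply]
  | succ N ih =>
    have pderiv_summand (q : ι) : pderiv p (X q * toPoly (fun a => c (Fin.cons q a))) =
        (if q = p then toPoly (fun a => c (Fin.cons q a)) else 0) +
          (N + 1) • (X q * toPoly (fun a => c (Fin.cons p (Fin.cons q a)))) := by
      rw [Derivation.leibniz, ih (hc.cons q), pderiv_X, Pi.single_apply]
      simp only [hc.swap q p, smul_eq_mul, mul_smul_comm]
      split_ifs <;> ring
    rw [toPoly_cons, map_sum, Finset.sum_congr rfl fun q _ => pderiv_summand q,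
      Finset.sum_add_distrib, ← Finset.smul_sum, ← toPoly_cons fun a => c (Fin.cons p a),
      Finset.sum_ite_eq', if_pos (Finset.mem_univ p), ← succ_nsmul']

theorem IsSymmArray.eq_zero_of_toPoly_eq_zero [CharZero A] [NoZeroDivisors A]
    {c : (Fin N → ι) → A} (hc : IsSymmArray c) (h : toPoly c = 0) : c = 0 := by
  induction N with
  | zero =>
    rw [toPoly_rank_zero, C_eq_zero] at h
    ext a
    rw [Subsingleton.elim a default, h, Pi.zero_apply]
  | succ N ih =>
    ext a
    have toPoly_slice := pderiv_toPoly hc (a 0)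
    rw [h, map_zero, eq_comm, smul_eq_zero_iff_right N.succ_ne_zero] at toPoly_slice
    simpa [Fin.cons_self_tail] using congrFun (ih (hc.cons _) toPoly_slice) (Fin.tail a)

theorem IsSymmArray.ext_of_toPoly [CharZero A] [NoZeroDivisors A] {c c' : (Fin N → ι) → A}
    (hc : IsSymmArray c) (hc' : IsSymmArray c') (h : toPoly c = toPoly c') : c = c' := by
  refine sub_eq_zero.1 (IsSymmArray.eq_zero_of_toPoly_eq_zero (fun π a => ?_) (by simp [h]))
  simp [hc π a, hc' π a]

variable {R : Type*} [CommRing R] [Algebra R A]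

/-- The quadratic form of a matrix, as a polynomial. -/
def quad (B : Matrix ι ι R) : MvPolynomial ι A := ∑ p, ∑ q, B p q • (X p * X q)

theorem toPoly_tensor (B : Matrix ι ι R) (c : (Fin N → ι) → A) :
    toPoly (fun a : Fin (N + 2) → ι =>
      B (a (Fin.natAdd N 0)) (a (Fin.natAdd N 1)) • c (fun j => a (Fin.castAdd 2 j))) =
      quad B * toPoly c := by
  simp only [toPoly_apply, quad]
  rw [← (Fin.appendEquiv N 2).sum_comp, Fintype.sum_prod_type_right, Finset.sum_mul,
    ← (finTwoArrowEquiv ι).symm.sum_comp, Fintype.sum_prod_type]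
  refine Finset.sum_congr rfl fun p _ => ?_
  rw [Finset.sum_mul]
  refine Finset.sum_congr rfl fun q _ => ?_
  rw [Finset.mul_sum]
  refine Finset.sum_congr rfl fun a _ => ?_
  simp only [Fin.appendEquiv, Equiv.coe_fn_mk, Fin.append_left, Fin.append_right,
    Fin.prod_univ_add, Fin.prod_univ_two]
  change (B p q • c a) • ((∏ i, X (a i)) * (X p * X q)) = _
  rw [smul_assoc, smul_mul_assoc, mul_smul_comm, mul_comm (X p * X q)]

/-- The second order operator `∑ S_{pq} ∂_p ∂_q` on polynomials. For the inverse matrix of a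
quadratic form this is the Laplacian, the counterpart of the trace of symmetric tensors. -/
def lap : Matrix ι ι R →ₗ[R] Module.End A (MvPolynomial ι A) where
  toFun S := ∑ p, ∑ q, S p q • ((pderiv p).toLinearMap ∘ₗ (pderiv q).toLinearMap)
  map_add' S T := by simp only [Matrix.add_apply, add_smul, Finset.sum_add_distrib]
  map_smul' r S := by
    simp only [Matrix.smul_apply, smul_assoc, Finset.smul_sum, RingHom.id_apply]

theorem lap_apply (S : Matrix ι ι R) (P : MvPolynomial ι A) :
    lap S P = ∑ p, ∑ q, S p q • pderiv p (pderiv q P) := by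
  simp [lap, LinearMap.sum_apply]

theorem toPoly_trace {c : (Fin (N + 2) → ι) → A} (hc : IsSymmArray c) (S : Matrix ι ι R) :
    ((N + 2) * (N + 1)) • toPoly (fun a => ∑ p, ∑ q, S p q • c (Fin.cons p (Fin.cons q a))) =
      lap S (toPoly c) := by
  have trace_eq : (fun a => ∑ p, ∑ q, S p q • c (Fin.cons p (Fin.cons q a))) =
      ∑ p, ∑ q, S p q • fun a => c (Fin.cons q (Fin.cons p a)) := by
    ext a
    simp only [Finset.sum_apply, Pi.smul_apply, hc.swap]
  rw [trace_eq, lap_apply]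
  simp only [map_sum, LinearMap.map_smul_of_tower, Finset.smul_sum]
  refine Finset.sum_congr rfl fun p _ => Finset.sum_congr rfl fun q _ => ?_
  rw [pderiv_toPoly hc, map_nsmul, pderiv_toPoly (hc.cons q), smul_comm, mul_smul]

theorem toPoly_contraction {c : ι → (Fin (N + 1) → ι) → A} (hc : ∀ p, IsSymmArray (c p))
    (S : Matrix ι ι R) :
    (N + 1) • toPoly (fun a => ∑ p, ∑ q, S p q • c p (Fin.cons q a)) =
      ∑ p, ∑ q, S p q • pderiv q (toPoly (c p)) := by
  have contraction_eq : (fun a => ∑ p, ∑ q, S p q • c p (Fin.cons q a)) =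
      ∑ p, ∑ q, S p q • fun a => c p (Fin.cons q a) := by
    ext a
    simp only [Finset.sum_apply, Pi.smul_apply]
  rw [contraction_eq]
  simp only [map_sum, LinearMap.map_smul_of_tower, Finset.smul_sum]
  refine Finset.sum_congr rfl fun p _ => Finset.sum_congr rfl fun q _ => ?_
  rw [pderiv_toPoly (hc p), smul_comm]

/-- The derivation of polynomials with `X_q ↦ ∑ Γ_{qr} X_r`, by which the Christoffel symbols
act on symmetric tensors. -/
def connDer (Γ : Matrix ι ι R) : Derivation A (MvPolynomial ι A) (MvPolynomial ι A) :=
  mkDerivation A fun q => ∑ r, Γ q r • X r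

theorem connDer_X (Γ : Matrix ι ι R) (q : ι) :
    connDer (A := A) Γ (X q) = ∑ r, Γ q r • X r := mkDerivation_X _ _ _

theorem toPoly_connDer (Γ : Matrix ι ι R) (c : (Fin N → ι) → A) :
    toPoly (fun a => ∑ k, ∑ q, Γ q (a k) • c (Function.update a k q)) = connDer Γ (toPoly c) := by
  induction N with
  | zero =>
    rw [toPoly_rank_zero, toPoly_rank_zero, ← algebraMap_eq, Derivation.map_algebraMap]
    simp
  | succ N ih =>
    rw [toPoly_cons, toPoly_cons c, map_sum]
    have split_first (s : ι) : (fun a : Fin N → ι => ∑ k, ∑ q,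
        Γ q ((Fin.cons s a : Fin (N + 1) → ι) k) • c (Function.update (Fin.cons s a) k q)) =
        (∑ q, Γ q s • fun a => c (Fin.cons q a)) +
          fun a => ∑ k, ∑ q, Γ q (a k) • c (Fin.cons s (Function.update a k q)) := by
      ext a
      rw [Fin.sum_univ_succ]
      simp [Finset.sum_apply, Fin.cons_update]
    have connDer_summand (s : ι) : connDer Γ (X s * toPoly fun a => c (Fin.cons s a)) =
        ∑ q, X q * Γ s q • toPoly (fun a => c (Fin.cons s a)) +
          X s * connDer Γ (toPoly fun a => c (Fin.cons s a)) := by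
      simp only [Derivation.leibniz, smul_eq_mul, connDer_X, Finset.mul_sum, mul_smul_comm]
      rw [add_comm]
      simp only [mul_comm]
    simp only [split_first, connDer_summand, map_add, mul_add, Finset.sum_add_distrib, map_sum,
      LinearMap.map_smul_of_tower, Finset.mul_sum]
    rw [Finset.sum_comm]
    simp only [← ih]

theorem derivation_sum_apply {κ S M : Type*} [CommRing S] [Algebra S A] [AddCommGroup M]
    [Module A M] [Module S M] (s : Finset κ) (D : κ → Derivation S A M) (P : A) :
    (∑ i ∈ s, D i) P = ∑ i ∈ s, D i P :=
  (congrFun (map_sum (Derivation.coeFnAddMonoidHom (R := S)) D s) P).trans (Finset.sum_apply ..)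

theorem connDer_quad (Γ B : Matrix ι ι R) :
    connDer Γ (quad B) = (quad (Γ.transpose * B + B * Γ) : MvPolynomial ι A) := by
  have connDer_summand (p q : ι) : connDer Γ (B p q • (X p * X q : MvPolynomial ι A)) =
      ∑ r, (Γ p r * B p q) • (X r * X q) + ∑ r, (B p q * Γ q r) • (X p * X r) := by
    simp only [Derivation.map_smul_of_tower, Derivation.leibniz, connDer_X, smul_eq_mul, smul_add,
      Finset.mul_sum, Finset.smul_sum, mul_smul_comm, smul_smul]
    rw [add_comm]
    simp only [mul_comm]
  simp only [quad, map_sum, connDer_summand, Finset.sum_add_distrib, Matrix.mul_apply,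
    Matrix.transpose_apply, Matrix.add_apply, add_smul, Finset.sum_smul]
  congr 1
  · rw [Finset.sum_comm_cycle]
    exact Finset.sum_congr rfl fun r _ => Finset.sum_comm
  · exact Finset.sum_congr rfl fun p _ => Finset.sum_comm

theorem pderiv_comm {σ : Type*} (p q : σ) (P : MvPolynomial σ A) :
    pderiv p (pderiv q P) = pderiv q (pderiv p P) := by
  classical
  have commutator_eq_zero : ⁅(pderiv p : Derivation A (MvPolynomial σ A) _), pderiv q⁆ = 0 :=
    derivation_ext fun i => by
      rw [Derivation.commutator_apply, pderiv_X, pderiv_X, Pi.single_apply, Pi.single_apply]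
      split_ifs <;> simp
  rw [← sub_eq_zero, ← Derivation.commutator_apply, commutator_eq_zero, Derivation.zero_apply]

theorem pderiv_connDer (Γ : Matrix ι ι R) (p : ι) (P : MvPolynomial ι A) :
    pderiv p (connDer Γ P) = connDer Γ (pderiv p P) + ∑ q, Γ q p • pderiv q P := by
  classical
  have commutator_eq : ⁅(pderiv p : Derivation A (MvPolynomial ι A) _), connDer Γ⁆ =
      ∑ q, Γ q p • (pderiv q : Derivation A (MvPolynomial ι A) _) :=
    derivation_ext fun i => by
      simp [Derivation.commutator_apply, connDer_X, pderiv_X, Pi.single_apply, apply_ite,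
        derivation_sum_apply]
  rw [← sub_eq_iff_eq_add', ← Derivation.commutator_apply, commutator_eq, derivation_sum_apply]
  rfl

theorem lap_connDer (S Γ : Matrix ι ι R) (P : MvPolynomial ι A) :
    lap S (connDer Γ P) = connDer Γ (lap S P) + lap (Γ * S + S * Γ.transpose) P := by
  have lap_summand (p q : ι) : S p q • pderiv p (pderiv q (connDer Γ P)) =
      connDer Γ (S p q • pderiv p (pderiv q P)) +
        (∑ r, (Γ r p * S p q) • pderiv r (pderiv q P) +
        ∑ r, (S p q * Γ r q) • pderiv p (pderiv r P)) := by
    simp only [pderiv_connDer, map_add, map_sum, Derivation.map_smul_of_tower, smul_add,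
      Finset.smul_sum, smul_smul, mul_comm, add_assoc]
  simp only [lap_apply, lap_summand, Finset.sum_add_distrib, map_sum, Matrix.add_apply,
    Matrix.mul_apply, Matrix.transpose_apply, add_smul, Finset.sum_smul]
  refine congrArg₂ (· + ·) rfl (congrArg₂ (· + ·) ?_ ?_)
  · rw [Finset.sum_comm_cycle]
    exact Finset.sum_congr rfl fun r _ => Finset.sum_comm
  · exact Finset.sum_congr rfl fun p _ => Finset.sum_comm

theorem pderiv_lap (S : Matrix ι ι R) (r : ι) (P : MvPolynomial ι A) :
    pderiv r (lap S P) = lap S (pderiv r P) := by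
  simp only [lap_apply, map_sum, Derivation.map_smul_of_tower, pderiv_comm r]

theorem isHomogeneous_lap {d : ℕ} {P : MvPolynomial ι A} (hP : P.IsHomogeneous d)
    (S : Matrix ι ι R) : (lap S P).IsHomogeneous (d - 2) := by
  rw [lap_apply]
  exact IsHomogeneous.sum _ _ _ fun p _ => IsHomogeneous.sum _ _ _ fun q _ =>
    (homogeneousSubmodule ι A (d - 2)).smul_of_tower_mem _ hP.pderiv.pderiv

theorem lap_eq_zero_of_isHomogeneous {d : ℕ} {P : MvPolynomial ι A} (hP : P.IsHomogeneous d)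
    (hd : d < 2) (S : Matrix ι ι R) : lap S P = 0 := by
  rw [lap_apply]
  refine Finset.sum_eq_zero fun p _ => Finset.sum_eq_zero fun q _ => ?_
  have degree : (pderiv q P).IsHomogeneous 0 := by
    simpa only [Nat.sub_eq_zero_of_le (Nat.lt_succ_iff.1 hd)] using hP.pderiv (i := q)
  rw [totalDegree_eq_zero_iff_eq_C.1 (degree.totalDegree_le.antisymm (Nat.zero_le _)), pderiv_C,
    smul_zero]

theorem lap_mul {S : Matrix ι ι R} (hS : S.IsSymm) (P P' : MvPolynomial ι A) :
    lap S (P * P') = lap S P * P' + P * lap S P' +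
      2 • ∑ q, (∑ p, S q p • pderiv p P) * pderiv q P' := by
  have leibniz_summand (p q : ι) : S p q • pderiv p (pderiv q (P * P')) =
      S p q • pderiv p (pderiv q P) * P' + P * S p q • pderiv p (pderiv q P') +
        (S q p • pderiv p P * pderiv q P' + S p q • pderiv q P * pderiv p P') := by
    simp only [Derivation.leibniz, map_add, smul_eq_mul, Algebra.smul_def, hS.apply p q]
    ring
  simp only [lap_apply, leibniz_summand, Finset.sum_add_distrib, Finset.sum_mul, Finset.mul_sum,
    two_smul]
  exact congrArg₂ (· + ·) rfl (congrArg₂ (· + ·) Finset.sum_comm rfl)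

theorem lap_X_mul {S : Matrix ι ι R} (hS : S.IsSymm) (r : ι) (P : MvPolynomial ι A) :
    lap S (X r * P) = X r * lap S P + 2 • ∑ q, S r q • pderiv q P := by
  classical
  have lap_X : lap S (X r : MvPolynomial ι A) = 0 := by
    simp [lap_apply, pderiv_X, Pi.single_apply, apply_ite]
  simp [lap_mul hS, lap_X, pderiv_X, Pi.single_apply, hS.apply]

theorem pderiv_quad {B : Matrix ι ι R} (hB : B.IsSymm) (p : ι) :
    pderiv p (quad B : MvPolynomial ι A) = 2 • ∑ q, B p q • X q := by
  classical
  simp [quad, Derivation.leibniz, pderiv_X, Pi.single_apply, Finset.sum_add_distrib, hB.apply p,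
    smul_add, two_mul]

theorem quad_isHomogeneous (B : Matrix ι ι R) :
    (quad B : MvPolynomial ι A).IsHomogeneous 2 :=
  IsHomogeneous.sum _ _ _ fun p _ => IsHomogeneous.sum _ _ _ fun q _ =>
    (homogeneousSubmodule ι A 2).smul_of_tower_mem _
      ((isHomogeneous_X A p).mul (isHomogeneous_X A q))

end Polynomials

section HornerSums

variable {S : Type*} [CommSemiring S]

/-- The sum `∑ q ^ (m - k) * P k` over `k ≤ m`, arranged by Horner's scheme. -/
def hornerSum (q : S) (P : ℕ → S) : ℕ → S
  | 0 => P 0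
  | m + 1 => q * hornerSum q P m + P (m + 1)

theorem hornerSum_eq_sum (q : S) (P : ℕ → S) (m : ℕ) :
    hornerSum q P m = ∑ k ∈ Finset.range (m + 1), q ^ (m - k) * P k := by
  induction m with
  | zero => simp [hornerSum]
  | succ m ih =>
    rw [hornerSum, ih, Finset.sum_range_succ _ (m + 1), Finset.mul_sum, Nat.sub_self, pow_zero,
      one_mul]
    congr 1
    refine Finset.sum_congr rfl fun k hk => ?_
    rw [Nat.succ_sub (Nat.lt_succ_iff.1 (Finset.mem_range.1 hk)), pow_succ', mul_assoc]

theorem hornerSum_eq_zero {q : S} {P : ℕ → S} {m : ℕ} (h : ∀ k ≤ m, P k = 0) :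
    hornerSum q P m = 0 := by
  rw [hornerSum_eq_sum]
  exact Finset.sum_eq_zero fun k hk => by
    rw [h k (Nat.lt_succ_iff.1 (Finset.mem_range.1 hk)), mul_zero]

theorem hornerSum_telescope {A : Type*} [CommRing A] {q : A} {D E u : ℕ → A} (hE0 : E 0 = u 0)
    (hE : ∀ k, E (k + 1) = D k - q * u k + u (k + 1)) (m : ℕ) :
    hornerSum q E (m + 1) = hornerSum q D m + u (m + 1) := by
  induction m with
  | zero =>
    simp only [hornerSum, hE0, hE]
    ring
  | succ m ih =>
    rw [hornerSum, ih, hE, hornerSum]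
    ring

end HornerSums

section HarmonicPolynomials

open MvPolynomial

variable {ι : Type*} [Fintype ι] {A : Type*} [CommRing A] {R : Type*} [CommRing R] [Algebra R A]

/-- The homogeneous polynomials of degree `d` annihilated by `lap S`, the counterparts of the
trace-free symmetric tensors of rank `d`. -/
def harmonicSubmodule (S : Matrix ι ι R) (d : ℕ) : Submodule A (MvPolynomial ι A) :=
  homogeneousSubmodule ι A d ⊓ LinearMap.ker (lap S)

theorem mem_harmonicSubmodule {S : Matrix ι ι R} {d : ℕ} {P : MvPolynomial ι A} :
    P ∈ harmonicSubmodule S d ↔ P.IsHomogeneous d ∧ lap S P = 0 := Iff.rfl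

variable [DecidableEq ι] {B : Matrix ι ι R}

theorem sum_inv_smul_pderiv_quad (hB : B.IsSymm) (hu : IsUnit B) (q : ι) :
    ∑ p, B⁻¹ q p • pderiv p (quad B : MvPolynomial ι A) = 2 • X q := by
  have inv_mul : B⁻¹ * B = 1 := B.nonsing_inv_mul (B.isUnit_iff_isUnit_det.1 hu)
  calc ∑ p, B⁻¹ q p • pderiv p (quad B : MvPolynomial ι A)
      = 2 • ∑ r, ∑ p, (B⁻¹ q p * B p r) • X r := by
        simp only [pderiv_quad hB, smul_comm _ 2, ← Finset.smul_sum, mul_smul]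
        simp only [Finset.smul_sum]
        rw [Finset.sum_comm]
    _ = 2 • X q := by
        simp only [← Finset.sum_smul, ← Matrix.mul_apply, inv_mul, Matrix.one_apply, ite_smul,
          one_smul, zero_smul, Finset.sum_ite_eq, Finset.mem_univ, if_true]

theorem lap_inv_quad (hB : B.IsSymm) (hu : IsUnit B) :
    lap B⁻¹ (quad B : MvPolynomial ι A) = (2 * Fintype.card ι) • 1 := by
  have sum_row (p : ι) :
      ∑ q, B⁻¹ p q • pderiv p (pderiv q (quad B : MvPolynomial ι A)) = 2 • 1 := by
    simpa only [map_sum, Derivation.map_smul_of_tower, map_nsmul, pderiv_X_self] using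
      congrArg (pderiv p) (sum_inv_smul_pderiv_quad (A := A) hB hu p)
  simp [lap_apply, sum_row, mul_comm]

theorem lap_inv_quad_mul (hB : B.IsSymm) (hu : IsUnit B) {d : ℕ} {P : MvPolynomial ι A}
    (hP : P.IsHomogeneous d) :
    lap B⁻¹ (quad B * P) =
      quad B * lap B⁻¹ P + (2 * (Fintype.card ι + 2 * d)) • P := by
  rw [lap_mul hB.inv, lap_inv_quad hB hu]
  simp only [sum_inv_smul_pderiv_quad hB hu, smul_mul_assoc, ← Finset.smul_sum,
    hP.sum_X_mul_pderiv]
  simp only [nsmul_eq_mul]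
  push_cast
  ring

theorem lap_inv_quad_pow_mul (hB : B.IsSymm) (hu : IsUnit B) {d : ℕ} {P : MvPolynomial ι A}
    (hP : P ∈ harmonicSubmodule B⁻¹ d) (s : ℕ) :
    lap B⁻¹ (quad B ^ (s + 1) * P) =
      (2 * (s + 1) * (Fintype.card ι + 2 * d + 2 * s)) • (quad B ^ s * P) := by
  rw [mem_harmonicSubmodule] at hP
  induction s with
  | zero =>
    rw [zero_add, pow_one, pow_zero, one_mul, lap_inv_quad_mul hB hu hP.1, hP.2, mul_zero,
      zero_add]
    ring_nf
  | succ s ih =>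
    rw [pow_succ', mul_assoc,
      lap_inv_quad_mul hB hu (((quad_isHomogeneous B).pow (s + 1)).mul hP.1), ih]
    simp only [nsmul_eq_mul]
    push_cast
    ring

/-- The factor by which the Laplacian of `quad B ^ (m - k + 1) * P` differs from
`quad B ^ (m - k) * P`, for a harmonic polynomial `P` of degree `d` in `n` variables. -/
def lapWeight (n d m k : ℕ) : ℕ := 2 * (m - k + 1) * (n + 2 * d + 2 * (m - k))

theorem lapWeight_ne_zero {n : ℕ} (hn : n ≠ 0) (d m k : ℕ) : lapWeight n d m k ≠ 0 := by
  unfold lapWeight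
  positivity

theorem lap_inv_quad_mul_hornerSum (hB : B.IsSymm) (hu : IsUnit B) {d : ℕ → ℕ}
    {P : ℕ → MvPolynomial ι A} (hP : ∀ k, P k ∈ harmonicSubmodule B⁻¹ (d k)) (m : ℕ) :
    lap B⁻¹ (quad B * hornerSum (quad B) P m) =
      hornerSum (quad B) (fun k => lapWeight (Fintype.card ι) (d k) m k • P k) m := by
  simp only [hornerSum_eq_sum, Finset.mul_sum, map_sum, ← mul_assoc, ← pow_succ',
    lap_inv_quad_pow_mul hB hu (hP _), lapWeight, mul_smul_comm]

end HarmonicPolynomials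

section HarmonicParts

open MvPolynomial

variable {ι : Type*} [Fintype ι] [DecidableEq ι] [Nonempty ι] {A : Type*} [CommRing A]
  {R : Type*} [Field R] [CharZero R] [Algebra R A] {B : Matrix ι ι R}

theorem eq_zero_of_hornerSum_eq_zero (hB : B.IsSymm) (hu : IsUnit B) {d : ℕ → ℕ} {m : ℕ}
    {P : ℕ → MvPolynomial ι A} (hP : ∀ k, P k ∈ harmonicSubmodule B⁻¹ (d k))
    (h : hornerSum (quad B) P m = 0) : ∀ k ≤ m, P k = 0 := by
  induction m generalizing P with
  | zero =>
    intro k hk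
    rwa [Nat.le_zero.1 hk]
  | succ m ih =>
    have eq_zero_of_le (k : ℕ) (hk : k ≤ m) : P k = 0 := by
      have lap_eq_zero := congrArg (lap B⁻¹) h
      rw [hornerSum, map_add, lap_inv_quad_mul_hornerSum hB hu hP, (hP (m + 1)).2, add_zero,
        map_zero] at lap_eq_zero
      have weight_smul_eq_zero :=
        ih (fun k => (harmonicSubmodule B⁻¹ (d k)).smul_of_tower_mem _ (hP k)) lap_eq_zero k hk
      rw [← Nat.cast_smul_eq_nsmul R] at weight_smul_eq_zero
      exact (smul_eq_zero.1 weight_smul_eq_zero).resolve_left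
        (Nat.cast_ne_zero.2 (lapWeight_ne_zero Fintype.card_ne_zero _ _ _))
    intro k hk
    rcases Nat.le_succ_iff.1 hk with hk | rfl
    · exact eq_zero_of_le k hk
    · rwa [hornerSum, hornerSum_eq_zero eq_zero_of_le, mul_zero, zero_add] at h

/-- The factor `c` for which `D - c • (quad B * lap B⁻¹ D)` is harmonic if `D` is a biharmonic
polynomial of degree `d` in `n` variables. The truncated subtraction is harmless, because
`lap B⁻¹ D = 0` for `d < 2`. -/
def biharmonicCoeff (R : Type*) [Field R] (n d : ℕ) : R := ((2 * (n + 2 * (d - 2)) : ℕ) : R)⁻¹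

theorem biharmonicCoeff_ne_zero {n : ℕ} (hn : n ≠ 0) (d : ℕ) : biharmonicCoeff R n d ≠ 0 :=
  inv_ne_zero (Nat.cast_ne_zero.2 (by positivity))

theorem sub_biharmonicCoeff_smul_mem_harmonicSubmodule (hB : B.IsSymm) (hu : IsUnit B) {d : ℕ}
    {D : MvPolynomial ι A} (hD : D.IsHomogeneous d) (hD2 : lap B⁻¹ (lap B⁻¹ D) = 0) :
    D - biharmonicCoeff R (Fintype.card ι) d • (quad B * lap B⁻¹ D) ∈
      harmonicSubmodule B⁻¹ d := by
  refine mem_harmonicSubmodule.2 ⟨?_, ?_⟩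
  · rcases lt_or_ge d 2 with hd | hd
    · simpa [lap_eq_zero_of_isHomogeneous hD hd] using hD
    · have degree := (quad_isHomogeneous B).mul (isHomogeneous_lap hD B⁻¹)
      rw [Nat.add_sub_cancel' hd] at degree
      exact hD.sub ((homogeneousSubmodule ι A d).smul_of_tower_mem _ degree)
  · rw [map_sub, LinearMap.map_smul_of_tower, lap_inv_quad_mul hB hu (isHomogeneous_lap hD B⁻¹),
      hD2, mul_zero, zero_add, ← Nat.cast_smul_eq_nsmul R, biharmonicCoeff, inv_smul_smul₀,
      sub_self]
    have := Fintype.card_ne_zero (α := ι)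
    exact Nat.cast_ne_zero.2 (by positivity)

theorem lap_inv_eq_of_hornerSum_eq_zero (hB : B.IsSymm) (hu : IsUnit B) {d : ℕ → ℕ}
    (hd : ∀ k, d (k + 1) = d k + 2) {D : ℕ → MvPolynomial ι A}
    (hD : ∀ k, (D k).IsHomogeneous (d k)) (hD2 : ∀ k, lap B⁻¹ (lap B⁻¹ (D k)) = 0) {m : ℕ}
    (h : hornerSum (quad B) D m = 0) (hm : lap B⁻¹ (D (m + 1)) = 0) :
    lap B⁻¹ (D 0) = 0 ∧ ∀ k ≤ m,
      biharmonicCoeff R (Fintype.card ι) (d (k + 1)) • lap B⁻¹ (D (k + 1)) =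
        -hornerSum (quad B) D k := by
  let u (k : ℕ) : MvPolynomial ι A := biharmonicCoeff R (Fintype.card ι) (d k) • lap B⁻¹ (D k)
  have u_mem (k : ℕ) : u k ∈ harmonicSubmodule B⁻¹ (d k - 2) :=
    (harmonicSubmodule B⁻¹ _).smul_of_tower_mem _ ⟨isHomogeneous_lap (hD k) _, hD2 k⟩
  let E : ℕ → MvPolynomial ι A
    | 0 => u 0
    | k + 1 => D k - quad B * u k + u (k + 1)
  let e : ℕ → ℕ
    | 0 => d 0 - 2
    | k + 1 => d k
  have E_mem (k : ℕ) : E k ∈ harmonicSubmodule B⁻¹ (e k) := by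
    cases k with
    | zero => exact u_mem 0
    | succ k =>
      have harmonicPart_mem : D k - quad B * u k ∈ harmonicSubmodule B⁻¹ (d k) := by
        rw [mul_smul_comm]
        exact sub_biharmonicCoeff_smul_mem_harmonicSubmodule hB hu (hD k) (hD2 k)
      have next_mem := u_mem (k + 1)
      rw [hd, Nat.add_sub_cancel] at next_mem
      exact Submodule.add_mem _ harmonicPart_mem next_mem
  have hornerSum_E (k : ℕ) : hornerSum (quad B) E (k + 1) = hornerSum (quad B) D k + u (k + 1) :=
    hornerSum_telescope (q := quad B) (D := D) (E := E) (u := u) rfl (fun _ => rfl) k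
  have E_eq_zero := eq_zero_of_hornerSum_eq_zero (m := m + 1) hB hu E_mem (by
    rw [hornerSum_E, h, zero_add]
    exact smul_eq_zero_of_right _ hm)
  refine ⟨(smul_eq_zero.1 (E_eq_zero 0 (Nat.zero_le _))).resolve_left
    (biharmonicCoeff_ne_zero Fintype.card_ne_zero _), fun k hk => ?_⟩
  rw [eq_neg_iff_add_eq_zero, add_comm, ← hornerSum_E]
  exact hornerSum_eq_zero fun j hj => E_eq_zero j (hj.trans (Nat.succ_le_succ hk))

end HarmonicParts

section MatrixCalculus

variable {E : Type*} [NormedAddCommGroup E] [NormedSpace ℝ E] {ι : Type*} [Fintype ι]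
  [DecidableEq ι] {F : E → Matrix ι ι ℝ} {s : Set E} {y : E} {k : WithTop ℕ∞}

theorem contDiffWithinAt_det (hF : ∀ a b, ContDiffWithinAt ℝ k (fun z => F z a b) s y) :
    ContDiffWithinAt ℝ k (fun z => (F z).det) s y := by
  simp only [Matrix.det_apply]
  exact ContDiffWithinAt.sum fun σ _ =>
    (contDiffWithinAt_prod fun i _ => hF _ _).const_smul _

theorem contDiffWithinAt_inv_apply (hF : ∀ a b, ContDiffWithinAt ℝ k (fun z => F z a b) s y)
    (hu : IsUnit (F y)) (a b : ι) : ContDiffWithinAt ℝ k (fun z => (F z)⁻¹ a b) s y := by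
  simp only [Matrix.inv_def, Ring.inverse_eq_inv', Matrix.smul_apply, smul_eq_mul,
    Matrix.adjugate_apply]
  refine ((contDiffWithinAt_det hF).inv
    ((Matrix.isUnit_iff_isUnit_det _).1 hu).ne_zero).mul (contDiffWithinAt_det fun i j => ?_)
  simp only [Matrix.updateRow_apply]
  split_ifs
  exacts [contDiffWithinAt_const, hF i j]

end MatrixCalculus

section PartialDerivatives

variable {n : ℕ} {W : Type*} [NormedAddCommGroup W] [NormedSpace ℝ W]
  {y : EuclideanSpace ℝ (Fin n)}

theorem partialDeriv_congr {F F' : EuclideanSpace ℝ (Fin n) → W} (h : F =ᶠ[nhds y] F')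
    (p : Fin n) : partialDeriv F y p = partialDeriv F' y p := by
  rw [partialDeriv, h.fderiv_eq, partialDeriv]

theorem partialDeriv_const (w : W) (p : Fin n) : partialDeriv (fun _ => w) y p = 0 := by
  simp [partialDeriv]

theorem partialDeriv_add {F F' : EuclideanSpace ℝ (Fin n) → W} (hF : DifferentiableAt ℝ F y)
    (hF' : DifferentiableAt ℝ F' y) (p : Fin n) :
    partialDeriv (fun z => F z + F' z) y p = partialDeriv F y p + partialDeriv F' y p := by
  simp [partialDeriv, fderiv_fun_add hF hF']

theorem partialDeriv_sum {ι : Type*} {s : Finset ι} {F : ι → EuclideanSpace ℝ (Fin n) → W}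
    (hF : ∀ i ∈ s, DifferentiableAt ℝ (F i) y) (p : Fin n) :
    partialDeriv (fun z => ∑ i ∈ s, F i z) y p = ∑ i ∈ s, partialDeriv (F i) y p := by
  simp [partialDeriv, fderiv_fun_sum hF]

theorem partialDeriv_smul {r : EuclideanSpace ℝ (Fin n) → ℝ} {F : EuclideanSpace ℝ (Fin n) → W}
    (hr : DifferentiableAt ℝ r y) (hF : DifferentiableAt ℝ F y) (p : Fin n) :
    partialDeriv (fun z => r z • F z) y p =
      r y • partialDeriv F y p + partialDeriv r y p • F y := by
  simp [partialDeriv, fderiv_fun_smul hr hF]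

theorem partialDeriv_const_smul {F : EuclideanSpace ℝ (Fin n) → W} (r : ℝ)
    (hF : DifferentiableAt ℝ F y) (p : Fin n) :
    partialDeriv (fun z => r • F z) y p = r • partialDeriv F y p := by
  simp [partialDeriv, fderiv_fun_const_smul hF]

variable {ι : Type*}

/-- The entrywise partial derivative `∂F/∂x^p` of a matrix depending on the coordinates. -/
def matrixDeriv (F : EuclideanSpace ℝ (Fin n) → Matrix ι ι ℝ) (y : EuclideanSpace ℝ (Fin n))
    (p : Fin n) : Matrix ι ι ℝ :=
  Matrix.of fun a b => partialDeriv (fun z => F z a b) y p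

variable [Fintype ι] {F F' : EuclideanSpace ℝ (Fin n) → Matrix ι ι ℝ}

theorem matrixDeriv_mul (hF : ∀ a b, DifferentiableAt ℝ (fun z => F z a b) y)
    (hF' : ∀ a b, DifferentiableAt ℝ (fun z => F' z a b) y) (p : Fin n) :
    matrixDeriv (fun z => F z * F' z) y p =
      F y * matrixDeriv F' y p + matrixDeriv F y p * F' y := by
  ext a b
  simp only [matrixDeriv, Matrix.of_apply, Matrix.mul_apply, Matrix.add_apply,
    ← Finset.sum_add_distrib]
  rw [partialDeriv_sum fun l _ => (hF a l).fun_mul (hF' l b)]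
  exact Finset.sum_congr rfl fun l _ => partialDeriv_smul (hF a l) (hF' l b) p

theorem matrixDeriv_inv [DecidableEq ι] (hF : ∀ a b, ContDiffAt ℝ 1 (fun z => F z a b) y)
    (hu : IsUnit (F y)) (p : Fin n) :
    matrixDeriv (fun z => (F z)⁻¹) y p = -((F y)⁻¹ * matrixDeriv F y p * (F y)⁻¹) := by
  have hF_within (a b : ι) : ContDiffWithinAt ℝ 1 (fun z => F z a b) Set.univ y :=
    (hF a b).contDiffWithinAt
  have hdet : IsUnit (F y).det := (Matrix.isUnit_iff_isUnit_det _).1 hu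
  have inv_mul_eventually_eq : (fun z => (F z)⁻¹ * F z) =ᶠ[nhds y] fun _ => 1 := by
    have det_continuousAt : ContinuousAt (fun z => (F z).det) y :=
      (contDiffWithinAt_det hF_within).continuousWithinAt.continuousAt Filter.univ_mem
    filter_upwards [det_continuousAt.eventually_ne hdet.ne_zero] with z hz
    exact Matrix.nonsing_inv_mul _ (isUnit_iff_ne_zero.2 hz)
  have deriv_eq_zero : matrixDeriv (fun z => (F z)⁻¹ * F z) y p = 0 := by
    ext a b
    simp only [matrixDeriv, Matrix.of_apply]
    rw [partialDeriv_congr (inv_mul_eventually_eq.mono fun z hz =>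
      congrFun (congrFun hz a) b),
      partialDeriv_const, Matrix.zero_apply]
  rw [matrixDeriv_mul
    (fun a b => ((contDiffWithinAt_inv_apply hF_within hu a b).contDiffAt
      Filter.univ_mem).differentiableAt one_ne_zero)
    (fun a b => (hF a b).differentiableAt one_ne_zero)] at deriv_eq_zero
  calc matrixDeriv (fun z => (F z)⁻¹) y p
      = matrixDeriv (fun z => (F z)⁻¹) y p * F y * (F y)⁻¹ := by
        rw [mul_assoc, Matrix.mul_nonsing_inv _ hdet, mul_one]
    _ = -((F y)⁻¹ * matrixDeriv F y p * (F y)⁻¹) := by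
        rw [← neg_mul, eq_neg_of_add_eq_zero_right deriv_eq_zero]

end PartialDerivatives

section Frames

theorem sum_smul_bilinear_of_frame {ι κ R V W : Type*} [Fintype ι] [Fintype κ] [CommRing R]
    [AddCommGroup V] [Module R V] [AddCommGroup W] [Module R W] (S : Matrix κ κ R)
    (A : Matrix ι κ R) {v : κ → V} {e : ι → V} (hv : ∀ p, v p = ∑ i, A i p • e i)
    (F : V →ₗ[R] V →ₗ[R] W) :
    ∑ p, ∑ q, S p q • F (v p) (v q) = ∑ i, ∑ j, (A * S * A.transpose) i j • F (e i) (e j) := by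
  simp only [hv, map_sum, LinearMap.sum_apply, map_smul, LinearMap.smul_apply, Matrix.mul_apply,
    Matrix.transpose_apply, Finset.smul_sum, Finset.sum_smul, Finset.sum_mul, smul_smul]
  refine (Finset.sum_congr rfl fun p _ => Finset.sum_comm_cycle).trans (Finset.sum_comm.trans ?_)
  refine Finset.sum_congr rfl fun i _ => Finset.sum_comm_cycle.trans ?_
  refine Finset.sum_congr rfl fun j _ => Finset.sum_comm.trans ?_
  exact Finset.sum_congr rfl fun q _ => Finset.sum_congr rfl fun p _ => by
    congr 1; ring

variable {n : ℕ} {M : Type*} [TopologicalSpace M] [ChartedSpace (EuclideanSpace ℝ (Fin n)) M]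

/-- The matrix of the coordinate vectors of the chart around `c` in the standard basis of the
tangent space. -/
def frameMatrix (c : M) (y : EuclideanSpace ℝ (Fin n)) : Matrix (Fin n) (Fin n) ℝ :=
  Matrix.of fun i p => (show EuclideanSpace ℝ (Fin n) from coordVec c y p) i

theorem eq_sum_smul_tangentBasis (x : M) (v : EuclideanSpace ℝ (Fin n)) :
    (v : TangentSpace (𝓡 n) x) = ∑ i, v i • tangentBasis x i := by
  have h := (EuclideanSpace.basisFun (Fin n) ℝ).sum_repr v
  simp only [EuclideanSpace.basisFun_apply] at h
  exact h.symm

theorem coordVec_eq_sum (c : M) (y : EuclideanSpace ℝ (Fin n)) (p : Fin n) :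
    coordVec c y p = ∑ i, frameMatrix c y i p • tangentBasis ((extChartAt (𝓡 n) c).symm y) i :=
  eq_sum_smul_tangentBasis _ _

variable [IsManifold (𝓡 n) ∞ M]

theorem coordVec_self (x : M) (p : Fin n) :
    (coordVec x (extChartAt (𝓡 n) x x) p : EuclideanSpace ℝ (Fin n)) =
      EuclideanSpace.single p (1 : ℝ) := by
  have : IsManifold (𝓡 n) 1 M := .of_le (n := ∞) (by simp)
  have h := mfderivWithin_range_extChartAt_symm (I := 𝓡 n) (x := x)
  rw [ModelWithCorners.range_eq_univ, mfderivWithin_univ] at h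
  exact congrArg (fun L : EuclideanSpace ℝ (Fin n) →L[ℝ] EuclideanSpace ℝ (Fin n) =>
    L (EuclideanSpace.single p (1 : ℝ))) h

theorem frameMatrix_self (x : M) : frameMatrix x (extChartAt (𝓡 n) x x) = 1 := by
  ext i p
  have := congrArg (fun v : EuclideanSpace ℝ (Fin n) => v i) (coordVec_self x p)
  simpa [frameMatrix, Matrix.one_apply] using this

theorem isUnit_frameMatrix (c : M) {y : EuclideanSpace ℝ (Fin n)}
    (hy : y ∈ (extChartAt (𝓡 n) c).target) : IsUnit (frameMatrix c y) := by
  have : IsManifold (𝓡 n) 1 M := .of_le (n := ∞) (by simp)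
  have chart_inverse := mfderivWithin_extChartAt_symm_comp_mfderiv_extChartAt (I := 𝓡 n) (x := c) hy
  rw [ModelWithCorners.range_eq_univ, mfderivWithin_univ] at chart_inverse
  let L : EuclideanSpace ℝ (Fin n) →L[ℝ] EuclideanSpace ℝ (Fin n) :=
    mfderiv 𝓘(ℝ, EuclideanSpace ℝ (Fin n)) (𝓡 n) (extChartAt (𝓡 n) c).symm y
  let L' : EuclideanSpace ℝ (Fin n) →L[ℝ] EuclideanSpace ℝ (Fin n) :=
    mfderiv (𝓡 n) 𝓘(ℝ, EuclideanSpace ℝ (Fin n)) (extChartAt (𝓡 n) c)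
      ((extChartAt (𝓡 n) c).symm y)
  have comp_eq_id : L.toLinearMap ∘ₗ L'.toLinearMap = LinearMap.id :=
    congrArg (fun T : EuclideanSpace ℝ (Fin n) →L[ℝ] EuclideanSpace ℝ (Fin n) => T.toLinearMap)
      chart_inverse
  let b := (EuclideanSpace.basisFun (Fin n) ℝ).toBasis
  have frameMatrix_eq : frameMatrix c y = LinearMap.toMatrix b b L.toLinearMap := by
    ext i p
    simp [frameMatrix, LinearMap.toMatrix_apply, b]
    rfl
  rw [frameMatrix_eq]
  refine IsUnit.of_mul_eq_one (LinearMap.toMatrix b b L'.toLinearMap) ?_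
  rw [← LinearMap.toMatrix_comp, comp_eq_id, LinearMap.toMatrix_id]

variable (g : Bundle.ContMDiffRiemannianMetric (𝓡 n) ∞ (EuclideanSpace ℝ (Fin n))
    (fun x : M => TangentSpace (𝓡 n) x))

theorem gram_isSymm (x : M) : (gram g x).IsSymm := by
  ext p q
  exact g.symm x _ _

theorem metricMatrix_isSymm (c : M) (y : EuclideanSpace ℝ (Fin n)) :
    (metricMatrix g c y).IsSymm := by
  ext p q
  exact g.symm _ _ _

theorem dotProduct_gram_mulVec (x : M) (v : EuclideanSpace ℝ (Fin n)) :
    v.ofLp ⬝ᵥ (gram g x).mulVec v.ofLp = g.inner x v v := by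
  change _ = metricForm g x (v : TangentSpace (𝓡 n) x) v
  conv_rhs => rw [eq_sum_smul_tangentBasis x v]
  simp only [map_sum, LinearMap.sum_apply, map_smul, LinearMap.smul_apply, smul_eq_mul,
    dotProduct, Matrix.mulVec, Finset.mul_sum, gram, Matrix.of_apply]
  rw [Finset.sum_comm]
  exact Finset.sum_congr rfl fun p _ => Finset.sum_congr rfl fun q _ => by ring

theorem isUnit_gram (x : M) : IsUnit (gram g x) := by
  rw [Matrix.isUnit_iff_isUnit_det, isUnit_iff_ne_zero]
  intro det_eq_zero
  obtain ⟨v, hv, gram_mulVec⟩ := Matrix.exists_mulVec_eq_zero_iff.2 det_eq_zero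
  have inner_eq_zero := dotProduct_gram_mulVec g x (WithLp.toLp 2 v)
  rw [gram_mulVec, dotProduct_zero] at inner_eq_zero
  exact (g.pos x _ fun h => hv (congrArg WithLp.ofLp h)).ne inner_eq_zero

theorem metricMatrix_eq (c : M) (y : EuclideanSpace ℝ (Fin n)) :
    metricMatrix g c y = (frameMatrix c y).transpose * gram g ((extChartAt (𝓡 n) c).symm y) *
      frameMatrix c y := by
  ext p q
  simp only [metricMatrix, Matrix.of_apply, coordVec_eq_sum, map_sum, LinearMap.sum_apply, map_smul,
    LinearMap.smul_apply, smul_eq_mul, Matrix.mul_apply, Matrix.transpose_apply, Finset.sum_mul,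
    gram, Finset.mul_sum]
  exact Finset.sum_congr rfl fun i _ => Finset.sum_congr rfl fun j _ => by ring

theorem isUnit_metricMatrix (c : M) {y : EuclideanSpace ℝ (Fin n)}
    (hy : y ∈ (extChartAt (𝓡 n) c).target) : IsUnit (metricMatrix g c y) := by
  have hA := isUnit_frameMatrix c hy
  rw [metricMatrix_eq]
  exact (((Matrix.isUnit_transpose _).2 hA).mul (isUnit_gram g _)).mul hA

theorem metricMatrix_self (x : M) : metricMatrix g x (extChartAt (𝓡 n) x x) = gram g x := by
  rw [metricMatrix_eq, frameMatrix_self, extChartAt_to_inv, Matrix.transpose_one, one_mul, mul_one]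

theorem sum_metricMatrix_inv_smul {W : Type*} [AddCommGroup W] [Module ℝ W] (c : M)
    {y : EuclideanSpace ℝ (Fin n)} (hy : y ∈ (extChartAt (𝓡 n) c).target)
    (F : TangentSpace (𝓡 n) ((extChartAt (𝓡 n) c).symm y) →ₗ[ℝ]
      TangentSpace (𝓡 n) ((extChartAt (𝓡 n) c).symm y) →ₗ[ℝ] W) :
    ∑ p, ∑ q, (metricMatrix g c y)⁻¹ p q • F (coordVec c y p) (coordVec c y q) =
      ∑ i, ∑ j, (gram g ((extChartAt (𝓡 n) c).symm y))⁻¹ i j •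
        F (tangentBasis _ i) (tangentBasis _ j) := by
  have hA : IsUnit (frameMatrix c y).det :=
    (Matrix.isUnit_iff_isUnit_det _).1 (isUnit_frameMatrix c hy)
  have hAt : IsUnit (frameMatrix c y).transpose.det := by rwa [Matrix.det_transpose]
  rw [sum_smul_bilinear_of_frame _ _ (coordVec_eq_sum c y), metricMatrix_eq, Matrix.mul_inv_rev,
    Matrix.mul_inv_rev, ← mul_assoc, Matrix.mul_nonsing_inv _ hA, one_mul, mul_assoc,
    Matrix.nonsing_inv_mul _ hAt, mul_one]

theorem contMDiffOn_coordVec (c : M) (p : Fin n) :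
    ContMDiffOn 𝓘(ℝ, EuclideanSpace ℝ (Fin n)) (𝓡 n).tangent ∞
      (fun y => Bundle.TotalSpace.mk' (EuclideanSpace ℝ (Fin n))
        (E := fun x : M => TangentSpace (𝓡 n) x) ((extChartAt (𝓡 n) c).symm y) (coordVec c y p))
      (extChartAt (𝓡 n) c).target := by
  have : IsManifold (𝓡 n) 1 M := .of_le (n := ∞) (by simp)
  have hs : IsOpen (extChartAt (𝓡 n) c).target := isOpen_extChartAt_target c
  have tangentMap_smooth := (contMDiffOn_extChartAt_symm (I := 𝓡 n)
    (n := ∞) c).contMDiffOn_tangentMapWithin (m := ∞) (by simp) hs.uniqueMDiffOn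
  have section_smooth : ContMDiffOn 𝓘(ℝ, EuclideanSpace ℝ (Fin n))
      𝓘(ℝ, EuclideanSpace ℝ (Fin n)).tangent ∞
      (fun y => (⟨y, EuclideanSpace.single p (1 : ℝ)⟩ :
        TangentBundle 𝓘(ℝ, EuclideanSpace ℝ (Fin n)) (EuclideanSpace ℝ (Fin n))))
      (extChartAt (𝓡 n) c).target :=
    contMDiffOn_vectorSpace_iff_contDiffOn.2 contDiffOn_const
  refine (tangentMap_smooth.comp section_smooth fun y hy => hy).congr fun y hy => ?_
  simp only [Function.comp_apply, tangentMapWithin, coordVec]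
  rw [mfderivWithin_of_isOpen hs hy]

theorem contDiffOn_metricMatrix (c : M) (p q : Fin n) :
    ContDiffOn ℝ ∞ (fun y => metricMatrix g c y p q) (extChartAt (𝓡 n) c).target := by
  have metric_smooth := g.contMDiff.comp_contMDiffOn
    (contMDiffOn_extChartAt_symm (I := 𝓡 n) (n := ∞) c)
  rw [← contMDiffOn_iff_contDiffOn]
  intro y hy
  have inner_smooth : ContMDiffWithinAt 𝓘(ℝ, EuclideanSpace ℝ (Fin n)) ((𝓡 n).prod 𝓘(ℝ)) ∞
      (fun y => Bundle.TotalSpace.mk' ℝ (E := Bundle.Trivial M ℝ) ((extChartAt (𝓡 n) c).symm y)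
        (g.inner ((extChartAt (𝓡 n) c).symm y) (coordVec c y p) (coordVec c y q)))
      (extChartAt (𝓡 n) c).target y := by
    apply ContMDiffWithinAt.clm_bundle_apply₂ (F₁ := EuclideanSpace ℝ (Fin n))
      (F₂ := EuclideanSpace ℝ (Fin n))
    · exact metric_smooth y hy
    · exact contMDiffOn_coordVec c p y hy
    · exact contMDiffOn_coordVec c q y hy
  exact ((Bundle.contMDiffWithinAt_totalSpace ..).1 inner_smooth).2

theorem contDiffOn_metricMatrix_inv (c : M) (p q : Fin n) :
    ContDiffOn ℝ ∞ (fun y => (metricMatrix g c y)⁻¹ p q) (extChartAt (𝓡 n) c).target :=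
  fun y hy => contDiffWithinAt_inv_apply (fun a b => contDiffOn_metricMatrix g c a b y hy)
    (isUnit_metricMatrix g c hy) p q

/-- The Christoffel symbols `Γ^q_{pr}` with fixed `p` as a matrix. -/
def christoffelMatrix (c : M) (y : EuclideanSpace ℝ (Fin n)) (p : Fin n) :
    Matrix (Fin n) (Fin n) ℝ :=
  Matrix.of fun q r => christoffel g c y q p r

theorem metricMatrix_mul_christoffelMatrix (c : M) {y : EuclideanSpace ℝ (Fin n)}
    (hy : y ∈ (extChartAt (𝓡 n) c).target) (p a r : Fin n) :
    (metricMatrix g c y * christoffelMatrix g c y p) a r =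
      (1 / 2 : ℝ) * (partialDeriv (fun z => metricMatrix g c z r a) y p
        + partialDeriv (fun z => metricMatrix g c z p a) y r
        - partialDeriv (fun z => metricMatrix g c z p r) y a) := by
  let L : Matrix (Fin n) (Fin n) ℝ := Matrix.of fun l r =>
    (1 / 2 : ℝ) * (partialDeriv (fun z => metricMatrix g c z r l) y p
      + partialDeriv (fun z => metricMatrix g c z p l) y r
      - partialDeriv (fun z => metricMatrix g c z p r) y l)
  have christoffelMatrix_eq : christoffelMatrix g c y p = (metricMatrix g c y)⁻¹ * L := by
    ext q r
    simp only [christoffelMatrix, christoffel, L, Matrix.mul_apply, Matrix.of_apply,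
      Finset.mul_sum, mul_left_comm]
  rw [christoffelMatrix_eq, Matrix.mul_nonsing_inv_cancel_left _ _
    ((Matrix.isUnit_iff_isUnit_det _).1 (isUnit_metricMatrix g c hy))]
  rfl

theorem matrixDeriv_metricMatrix (c : M) {y : EuclideanSpace ℝ (Fin n)}
    (hy : y ∈ (extChartAt (𝓡 n) c).target) (p : Fin n) :
    matrixDeriv (metricMatrix g c) y p =
      (christoffelMatrix g c y p).transpose * metricMatrix g c y +
        metricMatrix g c y * christoffelMatrix g c y p := by
  have metricMatrix_comm (a b : Fin n) :
      (fun z => metricMatrix g c z a b) = fun z => metricMatrix g c z b a :=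
    funext fun z => (metricMatrix_isSymm g c z).apply _ _
  have transpose_mul : (christoffelMatrix g c y p).transpose * metricMatrix g c y =
      (metricMatrix g c y * christoffelMatrix g c y p).transpose := by
    rw [Matrix.transpose_mul, (metricMatrix_isSymm g c y).eq]
  ext a b
  rw [transpose_mul, Matrix.add_apply, Matrix.transpose_apply,
    metricMatrix_mul_christoffelMatrix g c hy, metricMatrix_mul_christoffelMatrix g c hy,
    metricMatrix_comm b a, metricMatrix_comm p a, metricMatrix_comm p b, matrixDeriv,
    Matrix.of_apply]
  ring

theorem matrixDeriv_metricMatrix_inv (c : M) {y : EuclideanSpace ℝ (Fin n)}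
    (hy : y ∈ (extChartAt (𝓡 n) c).target) (p : Fin n) :
    matrixDeriv (fun z => (metricMatrix g c z)⁻¹) y p =
      -(christoffelMatrix g c y p * (metricMatrix g c y)⁻¹ +
        (metricMatrix g c y)⁻¹ * (christoffelMatrix g c y p).transpose) := by
  have hu := isUnit_metricMatrix g c hy
  have hdet := (Matrix.isUnit_iff_isUnit_det _).1 hu
  have entry_smooth (a b : Fin n) : ContDiffAt ℝ 1 (fun z => metricMatrix g c z a b) y :=
    ((contDiffOn_metricMatrix g c a b).contDiffAt
      ((isOpen_extChartAt_target c).mem_nhds hy)).of_le (by simp)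
  rw [matrixDeriv_inv entry_smooth hu, matrixDeriv_metricMatrix g c hy, mul_add, add_mul,
    Matrix.nonsing_inv_mul_cancel_left _ _ hdet, mul_assoc, mul_assoc,
    Matrix.mul_nonsing_inv _ hdet, mul_one, add_comm]

end Frames

section Fields

open MvPolynomial

variable {𝕜 : Type*} [RCLike 𝕜] {n N : ℕ} {M : Type*} [TopologicalSpace M]
  [ChartedSpace (EuclideanSpace ℝ (Fin n)) M]

/-- The components of a tensor field at `x` in the standard basis of `T_xM`. -/
def stdComponents (f : TensorField 𝕜 n M N) (x : M) (a : Fin N → Fin n) : 𝕜 :=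
  f x fun j => tangentBasis x (a j)

theorem ext_of_stdComponents {f f' : TensorField 𝕜 n M N} {x : M}
    (h : stdComponents f x = stdComponents f' x) : f x = f' x := by
  have ext_of_single (T T' : MultilinearMap ℝ (fun _ : Fin N => EuclideanSpace ℝ (Fin n)) 𝕜)
      (hT : ∀ a : Fin N → Fin n, T (fun j => EuclideanSpace.single (a j) (1 : ℝ)) =
        T' fun j => EuclideanSpace.single (a j) (1 : ℝ)) : T = T' :=
    Module.Basis.ext_multilinear (fun _ => (EuclideanSpace.basisFun (Fin n) ℝ).toBasis) fun a => by
      simpa only [OrthonormalBasis.coe_toBasis, EuclideanSpace.basisFun_apply] using hT a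
  exact ext_of_single _ _ fun a => congrFun h a

theorem isSymmArray_stdComponents {f : TensorField 𝕜 n M N} {x : M}
    (h : ∀ π : Equiv.Perm (Fin N), (f x).domDomCongr π = f x) :
    IsSymmArray (stdComponents f x) := fun π a =>
  congrArg (fun T : MultilinearMap ℝ (fun _ : Fin N => TangentSpace (𝓡 n) x) 𝕜 =>
    T fun j => tangentBasis x (a j)) (h π)

theorem domDomCongr_eq_of_isSymmArray {f : TensorField 𝕜 n M N} {x : M}
    (h : IsSymmArray (stdComponents f x)) (π : Equiv.Perm (Fin N)) :
    (f x).domDomCongr π = f x :=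
  ext_of_stdComponents (f := fun x => (f x).domDomCongr π) (funext fun a => h π a)

/-- The polynomial `w ↦ f(w, …, w)` on `T_xM`, which determines a symmetric tensor at `x`. -/
def polyAt (x : M) : TensorField 𝕜 n M N →ₗ[ℝ] MvPolynomial (Fin n) 𝕜 where
  toFun f := toPoly (stdComponents f x)
  map_add' f f' := map_add toPoly (stdComponents f x) (stdComponents f' x)
  map_smul' r f := LinearMap.map_smul_of_tower toPoly r (stdComponents f x)

theorem polyAt_eq (f : TensorField 𝕜 n M N) (x : M) : polyAt x f = toPoly (stdComponents f x) :=
  rfl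

theorem polyAt_isHomogeneous (f : TensorField 𝕜 n M N) (x : M) : (polyAt x f).IsHomogeneous N :=
  toPoly_isHomogeneous _

theorem polyAt_castRank {N' : ℕ} (h : N = N') (f : TensorField 𝕜 n M N) (x : M) :
    polyAt x (castRank h f) = polyAt x f := by
  subst h
  rfl

theorem ext_of_polyAt {f f' : TensorField 𝕜 n M N}
    (hf : ∀ x (π : Equiv.Perm (Fin N)), (f x).domDomCongr π = f x)
    (hf' : ∀ x (π : Equiv.Perm (Fin N)), (f' x).domDomCongr π = f' x)
    (h : ∀ x, polyAt x f = polyAt x f') : f = f' :=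
  funext fun x => ext_of_stdComponents <|
    (isSymmArray_stdComponents (hf x)).ext_of_toPoly (isSymmArray_stdComponents (hf' x)) (h x)

theorem isSmoothSymmetric_zero : IsSmoothSymmetric (0 : TensorField 𝕜 n M N) where
  symm _ _ := rfl
  smooth _ _ := contDiffOn_const (c := (0 : 𝕜))

theorem IsSmoothSymmetric.add {f f' : TensorField 𝕜 n M N} (hf : IsSmoothSymmetric f)
    (hf' : IsSmoothSymmetric f') : IsSmoothSymmetric (f + f') where
  symm x π := congrArg₂ (· + ·) (hf.symm x π) (hf'.symm x π)
  smooth c a := (hf.smooth c a).add (hf'.smooth c a)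

theorem IsSmoothSymmetric.smul {f : TensorField 𝕜 n M N} (hf : IsSmoothSymmetric f) (r : ℝ) :
    IsSmoothSymmetric (r • f) where
  symm x π := congrArg (r • ·) (hf.symm x π)
  smooth c a := (hf.smooth c a).const_smul r

theorem IsSmoothSymmetric.isSymmArray_components {f : TensorField 𝕜 n M N}
    (hf : IsSmoothSymmetric f) (c : M) (y : EuclideanSpace ℝ (Fin n)) :
    IsSymmArray (components f c y) := fun π a =>
  congrArg (fun T : MultilinearMap ℝ (fun _ : Fin N => EuclideanSpace ℝ (Fin n)) 𝕜 =>
    T fun j => coordVec c y (a j)) (hf.symm ((extChartAt (𝓡 n) c).symm y) π)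

theorem IsSmoothSymmetric.differentiableAt {f : TensorField 𝕜 n M N} (hf : IsSmoothSymmetric f)
    (c : M) {y : EuclideanSpace ℝ (Fin n)} (hy : y ∈ (extChartAt (𝓡 n) c).target)
    (a : Fin N → Fin n) : DifferentiableAt ℝ (fun z => components f c z a) y :=
  ((hf.smooth c a).contDiffAt ((isOpen_extChartAt_target c).mem_nhds hy)).differentiableAt (by simp)

theorem domDomCongr_symmetrize {V : Type*} [AddCommGroup V] [Module ℝ V]
    (T : MultilinearMap ℝ (fun _ : Fin N => V) 𝕜) (π : Equiv.Perm (Fin N)) :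
    (symmetrize T).domDomCongr π = symmetrize T := by
  ext v
  simp only [symmetrize, MultilinearMap.domDomCongr_apply, smul_apply, sum_apply]
  congr 1
  exact Fintype.sum_equiv (Equiv.mulLeft π) _ _ fun ρ => rfl

theorem toPoly_symmetrize (c : (Fin N → Fin n) → 𝕜) :
    toPoly (fun a => (N.factorial : ℝ)⁻¹ • ∑ π : Equiv.Perm (Fin N), c (a ∘ π)) = toPoly c := by
  have symmetrize_eq_smul_sum :
      (fun a => (N.factorial : ℝ)⁻¹ • ∑ π : Equiv.Perm (Fin N), c (a ∘ π)) =
        (N.factorial : ℝ)⁻¹ • ∑ π : Equiv.Perm (Fin N), fun a => c (a ∘ π) := by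
    ext a
    simp only [Pi.smul_apply, Finset.sum_apply]
  rw [symmetrize_eq_smul_sum, LinearMap.map_smul_of_tower, map_sum]
  simp only [toPoly_comp_perm, Finset.sum_const, Finset.card_univ, Fintype.card_perm,
    Fintype.card_fin]
  rw [← Nat.cast_smul_eq_nsmul ℝ, inv_smul_smul₀ (Nat.cast_ne_zero.2 N.factorial_ne_zero)]

theorem isSymmArray_contraction {c : (Fin (N + 2) → Fin n) → 𝕜} (hc : IsSymmArray c)
    (S : Matrix (Fin n) (Fin n) ℝ) :
    IsSymmArray fun a => ∑ p, ∑ q, S p q • c (Fin.cons p (Fin.cons q a)) := fun π a =>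
  Finset.sum_congr rfl fun p _ => Finset.sum_congr rfl fun q _ =>
    congrArg _ (((hc.cons p).cons q) π a)

variable [IsManifold (𝓡 n) ∞ M]

theorem components_self (f : TensorField 𝕜 n M N) (x : M) :
    components f x (extChartAt (𝓡 n) x x) = stdComponents f x := by
  ext a
  let f' : M → MultilinearMap ℝ (fun _ : Fin N => EuclideanSpace ℝ (Fin n)) 𝕜 := f
  change f' ((extChartAt (𝓡 n) x).symm (extChartAt (𝓡 n) x x))
    (fun j => coordVec x (extChartAt (𝓡 n) x x) (a j)) = _
  rw [extChartAt_to_inv]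
  exact congrArg (f' x) (funext fun j => coordVec_self x (a j))

variable (g : Bundle.ContMDiffRiemannianMetric (𝓡 n) ∞ (EuclideanSpace ℝ (Fin n))
    (fun x : M => TangentSpace (𝓡 n) x))

theorem components_mulMetric (f : TensorField 𝕜 n M N) (c : M) (y : EuclideanSpace ℝ (Fin n))
    (a : Fin (N + 2) → Fin n) :
    components (mulMetric g f) c y a = ((N + 2).factorial : ℝ)⁻¹ •
      ∑ π : Equiv.Perm (Fin (N + 2)), metricMatrix g c y (a (π (Fin.natAdd N 0)))
        (a (π (Fin.natAdd N 1))) • components f c y (fun j => a (π (Fin.castAdd 2 j))) := by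
  simp only [components, mulMetric, symmetrize, smul_apply, sum_apply]
  rfl

theorem IsSmoothSymmetric.mulMetric {f : TensorField 𝕜 n M N} (hf : IsSmoothSymmetric f) :
    IsSmoothSymmetric (mulMetric g f) where
  symm x π := domDomCongr_symmetrize _ π
  smooth c a := by
    simp only [components_mulMetric]
    exact (ContDiffOn.sum fun π _ => (contDiffOn_metricMatrix g c _ _).smul
      (hf.smooth c _)).const_smul _

theorem polyAt_mulMetric (f : TensorField 𝕜 n M N) (x : M) :
    polyAt x (mulMetric g f) = quad (gram g x) * polyAt x f := by
  rw [polyAt_eq, polyAt_eq, ← toPoly_tensor, ← components_self, ← components_self,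
    ← metricMatrix_self]
  exact (congrArg toPoly (funext fun a => components_mulMetric g f _ _ a)).trans
    (toPoly_symmetrize fun a => metricMatrix g x (extChartAt (𝓡 n) x x) (a (Fin.natAdd N 0))
      (a (Fin.natAdd N 1)) • components f x (extChartAt (𝓡 n) x x) fun j => a (Fin.castAdd 2 j))

theorem polyAt_mulMetricPow (f : TensorField 𝕜 n M N) (s : ℕ) (x : M) :
    polyAt x (mulMetricPow g f s) = quad (gram g x) ^ s * polyAt x f := by
  induction s with
  | zero => rw [pow_zero, one_mul]; rfl
  | succ s ih =>
    rw [pow_succ', mul_assoc, ← ih]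
    exact polyAt_mulMetric g _ x

theorem components_trace (f : TensorField 𝕜 n M (N + 2)) (c : M) {y : EuclideanSpace ℝ (Fin n)}
    (hy : y ∈ (extChartAt (𝓡 n) c).target) (a : Fin N → Fin n) :
    components (trace g f) c y a = ∑ p, ∑ q, (metricMatrix g c y)⁻¹ p q •
      components f c y (Fin.cons p (Fin.cons q a)) := by
  let V := TangentSpace (𝓡 n) ((extChartAt (𝓡 n) c).symm y)
  let T : MultilinearMap ℝ (fun _ : Fin (N + 2) => V) 𝕜 := f ((extChartAt (𝓡 n) c).symm y)
  let contracted : V →ₗ[ℝ] V →ₗ[ℝ] 𝕜 := LinearMap.mk₂ ℝ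
    (fun v w => T (Fin.cons v (Fin.cons w fun j => coordVec c y (a j))))
    (fun _ _ _ => T.cons_add _ _ _) (fun _ _ _ => T.cons_smul _ _ _)
    (fun v _ _ => (T.curryLeft v).cons_add _ _ _) (fun _ v _ => (T.curryLeft v).cons_smul _ _ _)
  have contracted_coordVec (p q : Fin n) : contracted (coordVec c y p) (coordVec c y q) =
      components f c y (Fin.cons p (Fin.cons q a)) := by
    refine congrArg T (funext fun k => ?_)
    exact Fin.cases rfl (fun k => Fin.cases rfl (fun _ => rfl) k) k
  simp only [← contracted_coordVec]
  rw [sum_metricMatrix_inv_smul g c hy contracted]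
  simp only [components, trace, sum_apply, smul_apply]
  rfl

theorem stdComponents_trace (f : TensorField 𝕜 n M (N + 2)) (x : M) :
    stdComponents (trace g f) x = fun a => ∑ p, ∑ q, (gram g x)⁻¹ p q •
      stdComponents f x (Fin.cons p (Fin.cons q a)) := by
  ext a
  rw [← components_self, components_trace g f x (mem_extChartAt_target x), metricMatrix_self,
    components_self]

theorem IsSmoothSymmetric.trace {f : TensorField 𝕜 n M (N + 2)} (hf : IsSmoothSymmetric f) :
    IsSmoothSymmetric (trace g f) where
  symm x := domDomCongr_eq_of_isSymmArray <| by
    rw [stdComponents_trace]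
    exact isSymmArray_contraction (isSymmArray_stdComponents (hf.symm x)) _
  smooth c a := by
    refine ContDiffOn.congr ?_ fun y hy => components_trace g f c hy a
    exact ContDiffOn.sum fun p _ => ContDiffOn.sum fun q _ =>
      (contDiffOn_metricMatrix_inv g c p q).smul (hf.smooth c _)

theorem polyAt_trace {f : TensorField 𝕜 n M (N + 2)} (hf : IsSmoothSymmetric f) (x : M) :
    ((N + 2) * (N + 1)) • polyAt x (trace g f) = lap (gram g x)⁻¹ (polyAt x f) := by
  rw [polyAt_eq, polyAt_eq, stdComponents_trace,
    toPoly_trace (isSymmArray_stdComponents (hf.symm x))]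

end Fields

section CovariantDerivatives

open MvPolynomial

variable {𝕜 : Type*} [RCLike 𝕜] {n N : ℕ} {M : Type*} [TopologicalSpace M]
  [ChartedSpace (EuclideanSpace ℝ (Fin n)) M]

/-- The polynomial on `T_xM` of the partial derivatives `∂_p f_{a_1 … a_N}` in the chart
around `x`. -/
def partialPoly (f : TensorField 𝕜 n M N) (x : M) (p : Fin n) : MvPolynomial (Fin n) 𝕜 :=
  toPoly fun a => partialDeriv (fun z => components f x z a) (extChartAt (𝓡 n) x x) p

theorem partialPoly_add {f f' : TensorField 𝕜 n M N} (hf : IsSmoothSymmetric f)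
    (hf' : IsSmoothSymmetric f') (x : M) (p : Fin n) :
    partialPoly (f + f') x p = partialPoly f x p + partialPoly f' x p :=
  (congrArg toPoly (funext fun a => partialDeriv_add
    (hf.differentiableAt x (mem_extChartAt_target x) a)
    (hf'.differentiableAt x (mem_extChartAt_target x) a) p)).trans (map_add toPoly _ _)

theorem partialPoly_smul {f : TensorField 𝕜 n M N} (hf : IsSmoothSymmetric f) (r : ℝ) (x : M)
    (p : Fin n) : partialPoly (r • f) x p = r • partialPoly f x p :=
  (congrArg toPoly (funext fun a => partialDeriv_const_smul r
    (hf.differentiableAt x (mem_extChartAt_target x) a) p)).trans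
    (LinearMap.map_smul_of_tower toPoly r _)

theorem IsSmoothSymmetric.isSymmArray_partialDeriv_components {f : TensorField 𝕜 n M N}
    (hf : IsSmoothSymmetric f) (c : M) (y : EuclideanSpace ℝ (Fin n)) (p : Fin n) :
    IsSymmArray fun a => partialDeriv (fun z => components f c z a) y p := fun π a => by
  simp only [hf.isSymmArray_components c _ π a]

variable [IsManifold (𝓡 n) ∞ M] (g : Bundle.ContMDiffRiemannianMetric (𝓡 n) ∞
  (EuclideanSpace ℝ (Fin n)) (fun x : M => TangentSpace (𝓡 n) x))

theorem differentiableAt_metricMatrix (c : M) {y : EuclideanSpace ℝ (Fin n)}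
    (hy : y ∈ (extChartAt (𝓡 n) c).target) (a b : Fin n) :
    DifferentiableAt ℝ (fun z => metricMatrix g c z a b) y :=
  ((contDiffOn_metricMatrix g c a b).contDiffAt
    ((isOpen_extChartAt_target c).mem_nhds hy)).differentiableAt (by simp)

theorem differentiableAt_metricMatrix_inv (c : M) {y : EuclideanSpace ℝ (Fin n)}
    (hy : y ∈ (extChartAt (𝓡 n) c).target) (a b : Fin n) :
    DifferentiableAt ℝ (fun z => (metricMatrix g c z)⁻¹ a b) y :=
  ((contDiffOn_metricMatrix_inv g c a b).contDiffAt
    ((isOpen_extChartAt_target c).mem_nhds hy)).differentiableAt (by simp)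

theorem partialPoly_mulMetric {f : TensorField 𝕜 n M N} (hf : IsSmoothSymmetric f) (x : M)
    (p : Fin n) :
    partialPoly (mulMetric g f) x p = quad (gram g x) * partialPoly f x p +
      quad (matrixDeriv (metricMatrix g x) (extChartAt (𝓡 n) x x) p) * polyAt x f := by
  have hy := mem_extChartAt_target (I := 𝓡 n) x
  rw [partialPoly, partialPoly, polyAt_eq, ← toPoly_tensor, ← toPoly_tensor, ← map_add,
    ← metricMatrix_self, ← components_self]
  refine Eq.trans (congrArg toPoly (funext fun a => ?_)) (toPoly_symmetrize _)
  have summand_differentiable (π : Equiv.Perm (Fin (N + 2))) : DifferentiableAt ℝ (fun z =>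
      metricMatrix g x z (a (π (Fin.natAdd N 0))) (a (π (Fin.natAdd N 1))) •
        components f x z (fun j => a (π (Fin.castAdd 2 j)))) (extChartAt (𝓡 n) x x) :=
    (differentiableAt_metricMatrix g x hy _ _).fun_smul (hf.differentiableAt x hy _)
  simp only [components_mulMetric]
  rw [partialDeriv_const_smul _ (DifferentiableAt.fun_sum fun π _ => summand_differentiable π),
    partialDeriv_sum fun π _ => summand_differentiable π]
  congr 1
  exact Finset.sum_congr rfl fun π _ => partialDeriv_smul
    (differentiableAt_metricMatrix g x hy _ _) (hf.differentiableAt x hy _) p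

theorem partialPoly_trace {f : TensorField 𝕜 n M (N + 2)} (hf : IsSmoothSymmetric f) (x : M)
    (p : Fin n) :
    ((N + 2) * (N + 1)) • partialPoly (trace g f) x p = lap (gram g x)⁻¹ (partialPoly f x p) +
      lap (matrixDeriv (fun z => (metricMatrix g x z)⁻¹) (extChartAt (𝓡 n) x x) p)
        (polyAt x f) := by
  have hy := mem_extChartAt_target (I := 𝓡 n) x
  have trace_eventually_eq (a : Fin N → Fin n) :
      (fun z => components (trace g f) x z a) =ᶠ[nhds (extChartAt (𝓡 n) x x)] fun z =>
        ∑ i, ∑ j, (metricMatrix g x z)⁻¹ i j • components f x z (Fin.cons i (Fin.cons j a)) :=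
    Filter.eventually_of_mem ((isOpen_extChartAt_target x).mem_nhds hy)
      fun z hz => components_trace g f x hz a
  have summand_differentiable (a : Fin N → Fin n) (i j : Fin n) : DifferentiableAt ℝ (fun z =>
      (metricMatrix g x z)⁻¹ i j • components f x z (Fin.cons i (Fin.cons j a)))
      (extChartAt (𝓡 n) x x) :=
    (differentiableAt_metricMatrix_inv g x hy i j).fun_smul (hf.differentiableAt x hy _)
  rw [partialPoly, partialPoly, polyAt_eq,
    ← toPoly_trace (hf.isSymmArray_partialDeriv_components _ _ p),
    ← toPoly_trace (isSymmArray_stdComponents (hf.symm x)), ← smul_add, ← map_add,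
    ← metricMatrix_self, ← components_self]
  congr 2
  ext a
  rw [partialDeriv_congr (trace_eventually_eq a), partialDeriv_sum fun i _ =>
    DifferentiableAt.fun_sum fun j _ => summand_differentiable a i j]
  simp only [partialDeriv_sum fun j _ => summand_differentiable a _ j, Pi.add_apply,
    ← Finset.sum_add_distrib]
  exact Finset.sum_congr rfl fun i _ => Finset.sum_congr rfl fun j _ => partialDeriv_smul
    (differentiableAt_metricMatrix_inv g x hy i j) (hf.differentiableAt x hy _) p

/-- The polynomial of `∇_p f` on `T_xM`. -/
def nablaPoly (f : TensorField 𝕜 n M N) (x : M) (p : Fin n) : MvPolynomial (Fin n) 𝕜 :=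
  toPoly (covDerivComponents g f x (extChartAt (𝓡 n) x x) p)

theorem nablaPoly_eq (f : TensorField 𝕜 n M N) (x : M) (p : Fin n) :
    nablaPoly g f x p = partialPoly f x p -
      connDer (christoffelMatrix g x (extChartAt (𝓡 n) x x) p) (polyAt x f) := by
  rw [polyAt_eq, ← toPoly_connDer, partialPoly, ← map_sub, nablaPoly, ← components_self]
  rfl

theorem nablaPoly_isHomogeneous (f : TensorField 𝕜 n M N) (x : M) (p : Fin n) :
    (nablaPoly g f x p).IsHomogeneous N :=
  toPoly_isHomogeneous _

theorem nablaPoly_add {f f' : TensorField 𝕜 n M N} (hf : IsSmoothSymmetric f)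
    (hf' : IsSmoothSymmetric f') (x : M) (p : Fin n) :
    nablaPoly g (f + f') x p = nablaPoly g f x p + nablaPoly g f' x p := by
  rw [nablaPoly_eq, nablaPoly_eq, nablaPoly_eq, partialPoly_add hf hf', map_add, map_add]
  ring

theorem nablaPoly_smul {f : TensorField 𝕜 n M N} (hf : IsSmoothSymmetric f) (r : ℝ) (x : M)
    (p : Fin n) : nablaPoly g (r • f) x p = r • nablaPoly g f x p := by
  rw [nablaPoly_eq, nablaPoly_eq, partialPoly_smul hf, map_smul, Derivation.map_smul_of_tower,
    smul_sub]

theorem nablaPoly_mulMetric {f : TensorField 𝕜 n M N} (hf : IsSmoothSymmetric f) (x : M)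
    (p : Fin n) : nablaPoly g (mulMetric g f) x p = quad (gram g x) * nablaPoly g f x p := by
  rw [nablaPoly_eq, nablaPoly_eq, polyAt_mulMetric, partialPoly_mulMetric g hf,
    matrixDeriv_metricMatrix g x (mem_extChartAt_target x), Derivation.leibniz, smul_eq_mul,
    smul_eq_mul, connDer_quad, metricMatrix_self]
  ring

theorem nablaPoly_trace {f : TensorField 𝕜 n M (N + 2)} (hf : IsSmoothSymmetric f) (x : M)
    (p : Fin n) : ((N + 2) * (N + 1)) • nablaPoly g (trace g f) x p =
      lap (gram g x)⁻¹ (nablaPoly g f x p) := by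
  rw [nablaPoly_eq, nablaPoly_eq, smul_sub, partialPoly_trace g hf,
    matrixDeriv_metricMatrix_inv g x (mem_extChartAt_target x), metricMatrix_self,
    ← map_nsmul, polyAt_trace g hf, map_sub, lap_connDer, map_neg, LinearMap.neg_apply]
  abel

end CovariantDerivatives

section Derivatives

open MvPolynomial

variable {𝕜 : Type*} [RCLike 𝕜] {n N : ℕ} {M : Type*} [TopologicalSpace M]
  [ChartedSpace (EuclideanSpace ℝ (Fin n)) M] [IsManifold (𝓡 n) ∞ M]
  (g : Bundle.ContMDiffRiemannianMetric (𝓡 n) ∞ (EuclideanSpace ℝ (Fin n))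
    (fun x : M => TangentSpace (𝓡 n) x))

theorem ofComponents_single (c : (Fin N → Fin n) → 𝕜) (a : Fin N → Fin n) :
    ofComponents c (fun j => EuclideanSpace.single (a j) (1 : ℝ)) = c a := by
  rw [ofComponents, sum_apply, Finset.sum_eq_single a]
  · simp
  · intro b _ hb
    obtain ⟨j, hj⟩ := Function.ne_iff.1 hb
    have prod_eq_zero : (∏ i, if b i = a i then (1 : ℝ) else 0) = 0 :=
      Finset.prod_eq_zero (Finset.mem_univ j) (if_neg hj)
    simp [prod_eq_zero]
  · simp

theorem stdComponents_covDeriv (f : TensorField 𝕜 n M N) (x : M) (a : Fin (N + 1) → Fin n) :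
    stdComponents (covDeriv g f) x a =
      covDerivComponents g f x (extChartAt (𝓡 n) x x) (a 0) (fun j => a j.succ) :=
  ofComponents_single _ a

theorem polyAt_innerDiff (f : TensorField 𝕜 n M N) (x : M) :
    polyAt x (innerDiff g f) = ∑ p, X p * nablaPoly g f x p := by
  have polyAt_symmetrize : polyAt x (innerDiff g f) = toPoly (stdComponents (covDeriv g f) x) := by
    refine Eq.trans (congrArg toPoly (funext fun a => ?_)) (toPoly_symmetrize _)
    simp only [stdComponents, innerDiff, symmetrize, smul_apply, sum_apply]
    rfl
  rw [polyAt_symmetrize, toPoly_cons]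
  simp only [stdComponents_covDeriv]
  rfl

theorem polyAt_innerDiff_add {f f' : TensorField 𝕜 n M N} (hf : IsSmoothSymmetric f)
    (hf' : IsSmoothSymmetric f') (x : M) : polyAt x (innerDiff g (f + f')) =
      polyAt x (innerDiff g f) + polyAt x (innerDiff g f') := by
  simp only [polyAt_innerDiff, nablaPoly_add g hf hf', mul_add, Finset.sum_add_distrib]

theorem polyAt_innerDiff_smul {f : TensorField 𝕜 n M N} (hf : IsSmoothSymmetric f) (r : ℝ)
    (x : M) : polyAt x (innerDiff g (r • f)) = r • polyAt x (innerDiff g f) := by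
  simp only [polyAt_innerDiff, nablaPoly_smul g hf, mul_smul_comm, Finset.smul_sum]

theorem polyAt_innerDiff_mulMetric {f : TensorField 𝕜 n M N} (hf : IsSmoothSymmetric f) (x : M) :
    polyAt x (innerDiff g (mulMetric g f)) = quad (gram g x) * polyAt x (innerDiff g f) := by
  simp only [polyAt_innerDiff, nablaPoly_mulMetric g hf, mul_left_comm, Finset.mul_sum]

theorem IsSmoothSymmetric.isSymmArray_covDerivComponents {f : TensorField 𝕜 n M N}
    (hf : IsSmoothSymmetric f) (c : M) (y : EuclideanSpace ℝ (Fin n)) (p : Fin n) :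
    IsSymmArray (covDerivComponents g f c y p) := by
  intro π a
  have components_comp_perm := fun z => hf.isSymmArray_components c z π
  simp only [covDerivComponents, components_comp_perm]
  congr 1
  refine Fintype.sum_equiv π _ _ fun k => Finset.sum_congr rfl fun q _ => ?_
  have update_comp : Function.update (a ∘ π) k q = Function.update a (π k) q ∘ π :=
    (Function.update_comp_eq_of_injective a π.injective k q).symm
  rw [update_comp, components_comp_perm]
  rfl

theorem stdComponents_trace_covDeriv (f : TensorField 𝕜 n M (N + 1)) (x : M) :
    stdComponents (trace g (covDeriv g f)) x = fun a => ∑ p, ∑ q, (gram g x)⁻¹ p q •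
      covDerivComponents g f x (extChartAt (𝓡 n) x x) p (Fin.cons q a) := by
  rw [stdComponents_trace]
  simp only [stdComponents_covDeriv]
  rfl

theorem domDomCongr_trace_covDeriv {f : TensorField 𝕜 n M (N + 1)} (hf : IsSmoothSymmetric f)
    (x : M) : ∀ π : Equiv.Perm (Fin N),
      (trace g (covDeriv g f) x).domDomCongr π = trace g (covDeriv g f) x := by
  refine domDomCongr_eq_of_isSymmArray ?_
  rw [stdComponents_trace_covDeriv]
  exact fun π a => Finset.sum_congr rfl fun p _ => Finset.sum_congr rfl fun q _ =>
    congrArg _ ((hf.isSymmArray_covDerivComponents g x _ p).cons q π a)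

theorem polyAt_trace_covDeriv {f : TensorField 𝕜 n M (N + 1)} (hf : IsSmoothSymmetric f) (x : M) :
    (N + 1) • polyAt x (trace g (covDeriv g f)) =
      ∑ p, ∑ q, (gram g x)⁻¹ p q • pderiv q (nablaPoly g f x p) := by
  rw [polyAt_eq, stdComponents_trace_covDeriv,
    toPoly_contraction fun p => hf.isSymmArray_covDerivComponents g x _ p]
  rfl

theorem lap_polyAt {f : TensorField 𝕜 n M N} (hf : IsSmoothSymmetric f) (h : IsTraceFree g f)
    (x : M) : lap (gram g x)⁻¹ (polyAt x f) = 0 := by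
  match N, f, hf, h with
  | 0, f, _, _ => exact lap_eq_zero_of_isHomogeneous (polyAt_isHomogeneous f x) two_pos _
  | 1, f, _, _ => exact lap_eq_zero_of_isHomogeneous (polyAt_isHomogeneous f x) one_lt_two _
  | N + 2, f, hf, h =>
    rw [← polyAt_trace g hf, show trace g f = 0 from h, map_zero, smul_zero]

theorem isTraceFree_of_lap_eq_zero {f : TensorField 𝕜 n M N} (hf : IsSmoothSymmetric f)
    (h : ∀ x, lap (gram g x)⁻¹ (polyAt x f) = 0) : IsTraceFree g f := by
  match N, f, hf, h with
  | 0, _, _, _ => trivial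
  | 1, _, _, _ => trivial
  | N + 2, f, hf, h =>
    refine ext_of_polyAt (hf.trace g).symm isSmoothSymmetric_zero.symm fun x => ?_
    have smul_polyAt_trace := polyAt_trace g hf x
    rw [h] at smul_polyAt_trace
    rw [(smul_eq_zero_iff_right (by positivity)).1 smul_polyAt_trace, map_zero]

theorem lap_nablaPoly {f : TensorField 𝕜 n M N} (hf : IsSmoothSymmetric f)
    (h : IsTraceFree g f) (x : M) (p : Fin n) : lap (gram g x)⁻¹ (nablaPoly g f x p) = 0 := by
  match N, f, hf, h with
  | 0, f, _, _ =>
    exact lap_eq_zero_of_isHomogeneous (nablaPoly_isHomogeneous g f x p) two_pos _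
  | 1, f, _, _ =>
    exact lap_eq_zero_of_isHomogeneous (nablaPoly_isHomogeneous g f x p) one_lt_two _
  | N + 2, f, hf, h =>
    rw [← nablaPoly_trace g hf, show trace g f = (0 : ℝ) • 0 from h.trans (zero_smul ℝ _).symm,
      nablaPoly_smul g isSmoothSymmetric_zero, zero_smul, smul_zero]

theorem lap_polyAt_innerDiff {f : TensorField 𝕜 n M N} (hf : IsSmoothSymmetric f)
    (h : IsTraceFree g f) (x : M) : lap (gram g x)⁻¹ (polyAt x (innerDiff g f)) =
      2 • ∑ p, ∑ q, (gram g x)⁻¹ p q • pderiv q (nablaPoly g f x p) := by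
  have gram_inv_isSymm : (gram g x)⁻¹.IsSymm := by
    rw [Matrix.IsSymm, Matrix.transpose_nonsing_inv, (gram_isSymm g x).eq]
  rw [polyAt_innerDiff, map_sum, Finset.smul_sum]
  refine Finset.sum_congr rfl fun p _ => ?_
  rw [lap_X_mul gram_inv_isSymm, lap_nablaPoly g hf h, mul_zero, zero_add]

theorem lap_polyAt_innerDiff_succ {f : TensorField 𝕜 n M (N + 1)} (hf : IsSmoothSymmetric f)
    (h : IsTraceFree g f) (x : M) : lap (gram g x)⁻¹ (polyAt x (innerDiff g f)) =
      (2 * (N + 1)) • polyAt x (trace g (covDeriv g f)) := by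
  rw [lap_polyAt_innerDiff g hf h, ← polyAt_trace_covDeriv g hf, mul_smul]

theorem lap_lap_polyAt_innerDiff {f : TensorField 𝕜 n M N} (hf : IsSmoothSymmetric f)
    (h : IsTraceFree g f) (x : M) :
    lap (gram g x)⁻¹ (lap (gram g x)⁻¹ (polyAt x (innerDiff g f))) = 0 := by
  rw [lap_polyAt_innerDiff g hf h, map_nsmul]
  simp only [map_sum, LinearMap.map_smul_of_tower, ← pderiv_lap, lap_nablaPoly g hf h, map_zero,
    smul_zero, Finset.sum_const_zero]

end Derivatives

section Expansions

open MvPolynomial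

variable {𝕜 : Type*} [RCLike 𝕜] {n N ε : ℕ} {M : Type*} [TopologicalSpace M]
  [ChartedSpace (EuclideanSpace ℝ (Fin n)) M]

theorem IsSmoothSymmetric.sub {f f' : TensorField 𝕜 n M N} (hf : IsSmoothSymmetric f)
    (hf' : IsSmoothSymmetric f') : IsSmoothSymmetric (f - f') := by
  rw [sub_eq_add_neg, ← neg_one_smul ℝ]
  exact hf.add (hf'.smul (-1))

theorem IsSmoothSymmetric.castRank {N' : ℕ} (h : N = N') {f : TensorField 𝕜 n M N}
    (hf : IsSmoothSymmetric f) : IsSmoothSymmetric (castRank h f) := by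
  subst h
  exact hf

theorem IsSmoothSymmetric.sum {α : Type*} [Fintype α] {f : α → TensorField 𝕜 n M N}
    (hf : ∀ i, IsSmoothSymmetric (f i)) : IsSmoothSymmetric (∑ i, f i) :=
  Finset.sum_induction f IsSmoothSymmetric (fun _ _ => IsSmoothSymmetric.add)
    isSmoothSymmetric_zero fun i _ => hf i

variable [IsManifold (𝓡 n) ∞ M] (g : Bundle.ContMDiffRiemannianMetric (𝓡 n) ∞
  (EuclideanSpace ℝ (Fin n)) (fun x : M => TangentSpace (𝓡 n) x))

theorem IsSmoothSymmetric.mulMetricPow {f : TensorField 𝕜 n M N} (hf : IsSmoothSymmetric f) :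
    ∀ s, IsSmoothSymmetric (mulMetricPow g f s)
  | 0 => hf
  | s + 1 => (hf.mulMetricPow s).mulMetric g

/-- Smooth symmetric trace-free tensor fields, the coefficients of harmonic expansions: their
polynomials on the tangent spaces are harmonic. -/
structure IsHarmonicField (f : TensorField 𝕜 n M N) : Prop where
  smoothSymmetric : IsSmoothSymmetric f
  traceFree : IsTraceFree g f

theorem isHarmonicField_zero : IsHarmonicField g (0 : TensorField 𝕜 n M N) :=
  ⟨isSmoothSymmetric_zero, isTraceFree_of_lap_eq_zero g isSmoothSymmetric_zero fun x => by
    rw [map_zero, map_zero]⟩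

variable {g}

theorem IsHarmonicField.polyAt_mem {f : TensorField 𝕜 n M N} (hf : IsHarmonicField g f) (x : M) :
    polyAt x f ∈ harmonicSubmodule (gram g x)⁻¹ N :=
  ⟨polyAt_isHomogeneous f x, lap_polyAt g hf.smoothSymmetric hf.traceFree x⟩

theorem IsHarmonicField.smul {f : TensorField 𝕜 n M N} (hf : IsHarmonicField g f) (r : ℝ) :
    IsHarmonicField g (r • f) :=
  ⟨hf.smoothSymmetric.smul r, isTraceFree_of_lap_eq_zero g (hf.smoothSymmetric.smul r) fun x => by
    rw [map_smul, LinearMap.map_smul_of_tower, (hf.polyAt_mem x).2, smul_zero]⟩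

variable (g)

/-- The sum `∑ i ^ (m - k) h k` over `k ≤ m`, arranged by Horner's scheme. -/
def metricHorner (h : ∀ k : ℕ, TensorField 𝕜 n M (ε + 2 * k)) :
    ∀ m : ℕ, TensorField 𝕜 n M (ε + 2 * m)
  | 0 => h 0
  | m + 1 => mulMetric g (metricHorner h m) + h (m + 1)

theorem metricHorner_congr {h h' : ∀ k : ℕ, TensorField 𝕜 n M (ε + 2 * k)} {m : ℕ}
    (hh : ∀ k ≤ m, h k = h' k) : metricHorner g h m = metricHorner g h' m := by
  induction m with
  | zero => exact hh 0 le_rfl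
  | succ m ih =>
    rw [metricHorner, metricHorner, hh (m + 1) le_rfl, ih fun k hk => hh k (hk.trans m.le_succ)]

theorem isSmoothSymmetric_metricHorner {h : ∀ k : ℕ, TensorField 𝕜 n M (ε + 2 * k)}
    (hh : ∀ k, IsSmoothSymmetric (h k)) : ∀ m, IsSmoothSymmetric (metricHorner g h m)
  | 0 => hh 0
  | m + 1 => ((isSmoothSymmetric_metricHorner hh m).mulMetric g).add (hh (m + 1))

theorem polyAt_metricHorner (h : ∀ k : ℕ, TensorField 𝕜 n M (ε + 2 * k)) (m : ℕ) (x : M) :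
    polyAt x (metricHorner g h m) = hornerSum (quad (gram g x)) (fun k => polyAt x (h k)) m := by
  induction m with
  | zero => rfl
  | succ m ih =>
    rw [hornerSum, ← ih, ← polyAt_mulMetric]
    exact map_add _ _ _

theorem polyAt_innerDiff_metricHorner {h : ∀ k : ℕ, TensorField 𝕜 n M (ε + 2 * k)}
    (hh : ∀ k, IsSmoothSymmetric (h k)) (m : ℕ) (x : M) :
    polyAt x (innerDiff g (metricHorner g h m)) =
      hornerSum (quad (gram g x)) (fun k => polyAt x (innerDiff g (h k))) m := by
  induction m with
  | zero => rfl
  | succ m ih =>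
    have smooth := isSmoothSymmetric_metricHorner g hh m
    rw [hornerSum, ← ih, ← polyAt_innerDiff_mulMetric g smooth]
    exact polyAt_innerDiff_add g (smooth.mulMetric g) (hh (m + 1)) x

theorem metricHorner_eq_sum {h : ∀ k : ℕ, TensorField 𝕜 n M (ε + 2 * k)}
    (hh : ∀ k, IsSmoothSymmetric (h k)) (m : ℕ) : metricHorner g h m = ∑ k : Fin (m + 1),
      castRank (by have := k.isLt; omega) (mulMetricPow g (h k) (m - (k : ℕ))) := by
  refine ext_of_polyAt (isSmoothSymmetric_metricHorner g hh m).symm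
    (IsSmoothSymmetric.sum fun k : Fin (m + 1) => ((hh k).mulMetricPow g _).castRank _).symm
    fun x => ?_
  rw [polyAt_metricHorner, hornerSum_eq_sum, Finset.sum_range, map_sum]
  simp only [polyAt_castRank, polyAt_mulMetricPow]

section Existence

/-- The coefficients of a harmonic expansion divided by the factors by which the trace of
`i (∑ i ^ (m - k) u k)` multiplies them. -/
def unweighted (u : ∀ k : ℕ, TensorField 𝕜 n M (ε + 2 * k)) (m k : ℕ) :
    TensorField 𝕜 n M (ε + 2 * k) :=
  (lapWeight n (ε + 2 * k) m k : ℝ)⁻¹ • u k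

variable {g} in
theorem isHarmonicField_unweighted {u : ∀ k : ℕ, TensorField 𝕜 n M (ε + 2 * k)}
    (hu : ∀ k, IsHarmonicField g (u k)) (m k : ℕ) : IsHarmonicField g (unweighted u m k) :=
  (hu k).smul _

theorem lap_quad_mul_polyAt_metricHorner_unweighted (hn : n ≠ 0)
    {u : ∀ k : ℕ, TensorField 𝕜 n M (ε + 2 * k)} (hu : ∀ k, IsHarmonicField g (u k)) (m : ℕ)
    (x : M) :
    lap (gram g x)⁻¹ (quad (gram g x) * polyAt x (metricHorner g (unweighted u m) m)) =
      polyAt x (metricHorner g u m) := by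
  rw [polyAt_metricHorner, polyAt_metricHorner, lap_inv_quad_mul_hornerSum (gram_isSymm g x)
    (isUnit_gram g x) (fun k => (isHarmonicField_unweighted hu m k).polyAt_mem x), Fintype.card_fin]
  congr 1
  ext1 k
  rw [unweighted, map_smul, ← Nat.cast_smul_eq_nsmul ℝ,
    smul_inv_smul₀ (Nat.cast_ne_zero.2 (lapWeight_ne_zero hn _ m k))]

theorem isHarmonicField_sub_mulMetric {m : ℕ} {f : TensorField 𝕜 n M (ε + 2 * m + 2)}
    (hf : IsSmoothSymmetric f) {u : ∀ k : ℕ, TensorField 𝕜 n M (ε + 2 * k)}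
    (hu : ∀ k, IsHarmonicField g (u k))
    (h : metricHorner g u m = (((ε + 2 * m + 2) * (ε + 2 * m + 1) : ℕ) : ℝ) • trace g f) :
    IsHarmonicField g (f - mulMetric g (metricHorner g (unweighted u m) m)) := by
  have smooth_metricHorner := isSmoothSymmetric_metricHorner g
    (fun k => (isHarmonicField_unweighted hu m k).smoothSymmetric) m
  have smooth := hf.sub (smooth_metricHorner.mulMetric g)
  refine ⟨smooth, isTraceFree_of_lap_eq_zero g smooth fun x => ?_⟩
  rcases eq_or_ne n 0 with rfl | hn
  · simp [lap_apply]
  · rw [map_sub, map_sub, polyAt_mulMetric, lap_quad_mul_polyAt_metricHorner_unweighted g hn hu, h,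
      map_smul, Nat.cast_smul_eq_nsmul, polyAt_trace g hf, sub_self]

theorem exists_metricHorner_eq (hε : ε = 0 ∨ ε = 1) {m : ℕ} {f : TensorField 𝕜 n M (ε + 2 * m)}
    (hf : IsSmoothSymmetric f) : ∃ h : ∀ k : ℕ, TensorField 𝕜 n M (ε + 2 * k),
      (∀ k, IsHarmonicField g (h k)) ∧ metricHorner g h m = f := by
  induction m with
  | zero =>
    refine ⟨Function.update (fun _ => 0) 0 f,
      (Function.forall_update_iff _ fun _ => IsHarmonicField g).2
        ⟨⟨hf, ?_⟩, fun k _ => isHarmonicField_zero g⟩, by rw [metricHorner, Function.update_self]⟩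
    rcases hε with rfl | rfl <;> trivial
  | succ m ih =>
    obtain ⟨u, u_harmonic, u_eq⟩ := ih ((IsSmoothSymmetric.trace g hf).smul
      (((ε + 2 * m + 2) * (ε + 2 * m + 1) : ℕ) : ℝ))
    refine ⟨Function.update (unweighted u m) (m + 1)
      (f - mulMetric g (metricHorner g (unweighted u m) m)),
      (Function.forall_update_iff _ fun _ => IsHarmonicField g).2
        ⟨isHarmonicField_sub_mulMetric g hf u_harmonic u_eq,
          fun k _ => isHarmonicField_unweighted u_harmonic m k⟩, ?_⟩
    rw [metricHorner, Function.update_self, metricHorner_congr g fun k hk =>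
      Function.update_of_ne (Nat.lt_succ_of_le hk).ne _ _]
    exact add_sub_cancel _ _

theorem exists_isHarmonicExpansion (hε : ε = 0 ∨ ε = 1) {m : ℕ}
    {f : TensorField 𝕜 n M (ε + 2 * m)} (hf : IsSmoothSymmetric f) :
    ∃ h : ∀ k : Fin (m + 1), TensorField 𝕜 n M (ε + 2 * (k : ℕ)), IsHarmonicExpansion g f h := by
  obtain ⟨h, h_harmonic, rfl⟩ := exists_metricHorner_eq g hε hf
  exact ⟨fun k => h k, fun k => (h_harmonic k).smoothSymmetric, fun k => (h_harmonic k).traceFree,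
    metricHorner_eq_sum g (fun k => (h_harmonic k).smoothSymmetric) m⟩

end Existence

end Expansions

section Divergences

variable {𝕜 : Type*} [RCLike 𝕜] {n N ε m : ℕ} {M : Type*} [TopologicalSpace M]
  [ChartedSpace (EuclideanSpace ℝ (Fin n)) M] [IsManifold (𝓡 n) ∞ M]
  {g : Bundle.ContMDiffRiemannianMetric (𝓡 n) ∞ (EuclideanSpace ℝ (Fin n))
    (fun x : M => TangentSpace (𝓡 n) x)}

theorem IsHarmonicExpansion.exists_metricHorner_eq {f : TensorField 𝕜 n M (ε + 2 * m)}
    {h : ∀ k : Fin (m + 1), TensorField 𝕜 n M (ε + 2 * (k : ℕ))} (hh : IsHarmonicExpansion g f h) :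
    ∃ h' : ∀ k : ℕ, TensorField 𝕜 n M (ε + 2 * k), (∀ k, IsHarmonicField g (h' k)) ∧
      (∀ k : Fin (m + 1), h' k = h k) ∧ h' (m + 1) = 0 ∧ metricHorner g h' m = f := by
  let h' (k : ℕ) : TensorField 𝕜 n M (ε + 2 * k) := if hk : k < m + 1 then h ⟨k, hk⟩ else 0
  have h'_eq (k : Fin (m + 1)) : h' k = h k := dif_pos k.isLt
  have h'_harmonic (k : ℕ) : IsHarmonicField g (h' k) := by
    by_cases hk : k < m + 1
    · rw [h'_eq ⟨k, hk⟩]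
      exact ⟨hh.smoothSymmetric _, hh.traceFree _⟩
    · rw [show h' k = 0 from dif_neg hk]
      exact isHarmonicField_zero g
  refine ⟨h', h'_harmonic, h'_eq, dif_neg (lt_irrefl _), ?_⟩
  rw [metricHorner_eq_sum g fun k => (h'_harmonic k).smoothSymmetric, hh.eq_sum]
  simp only [h'_eq]

theorem innerDiff_zero : innerDiff g (0 : TensorField 𝕜 n M N) = 0 :=
  ext_of_polyAt (fun _ => domDomCongr_symmetrize _) isSmoothSymmetric_zero.symm fun x => by
    rw [← zero_smul ℝ (0 : TensorField 𝕜 n M N), polyAt_innerDiff_smul g isSmoothSymmetric_zero,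
      zero_smul, map_zero]

theorem isPotential_zero : IsPotential g (0 : TensorField 𝕜 n M N) := by
  cases N with
  | zero => rfl
  | succ N => exact ⟨0, isSmoothSymmetric_zero, innerDiff_zero.symm⟩

theorem divergence_eq_zero_of_dim_zero (hn : n = 0) (f : TensorField 𝕜 n M N) :
    divergence g f = 0 := by
  subst hn
  match N, f with
  | 0, _ => rfl
  | _ + 1, f =>
    funext x
    change trace g (covDeriv g f) x = 0
    rw [trace, Fin.sum_univ_zero]

theorem divergence_eq_zero_of_lap {f : TensorField 𝕜 n M N} (hf : IsHarmonicField g f)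
    (h : ∀ x, lap (gram g x)⁻¹ (polyAt x (innerDiff g f)) = 0) : divergence g f = 0 := by
  match N, f, hf, h with
  | 0, _, _, _ => rfl
  | N + 1, f, hf, h =>
    refine ext_of_polyAt (domDomCongr_trace_covDeriv g hf.smoothSymmetric)
      isSmoothSymmetric_zero.symm fun x => ?_
    have smul_polyAt_eq := lap_polyAt_innerDiff_succ g hf.smoothSymmetric hf.traceFree x
    rw [h] at smul_polyAt_eq
    rw [map_zero]
    exact (smul_eq_zero_iff_right (by positivity)).1 smul_polyAt_eq.symm

theorem trace_covDeriv_eq_innerDiff {f : TensorField 𝕜 n M (N + 2)} (hf : IsHarmonicField g f)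
    {v : TensorField 𝕜 n M N} (hv : IsSmoothSymmetric v) {c : ℝ} (hc : c ≠ 0)
    (h : ∀ x, c • lap (gram g x)⁻¹ (polyAt x (innerDiff g f)) = -polyAt x (innerDiff g v)) :
    trace g (covDeriv g f) = innerDiff g (-(c * (2 * (N + 2) : ℕ))⁻¹ • v) := by
  have coeff_ne_zero : c * (2 * (N + 2) : ℕ) ≠ 0 :=
    mul_ne_zero hc (Nat.cast_ne_zero.2 (by positivity))
  refine ext_of_polyAt (domDomCongr_trace_covDeriv g hf.smoothSymmetric)
    (fun _ => domDomCongr_symmetrize _) fun x => ?_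
  rw [polyAt_innerDiff_smul g hv, neg_smul, ← smul_neg, ← h, eq_inv_smul_iff₀ coeff_ne_zero,
    mul_smul, Nat.cast_smul_eq_nsmul, lap_polyAt_innerDiff_succ g hf.smoothSymmetric hf.traceFree]

theorem lap_polyAt_innerDiff_of_metricHorner {h : ∀ k : ℕ, TensorField 𝕜 n M (ε + 2 * k)}
    (hh : ∀ k, IsHarmonicField g (h k)) (hm : h (m + 1) = 0)
    (hd : innerDiff g (metricHorner g h m) = 0) (hn : n ≠ 0) (x : M) :
    lap (gram g x)⁻¹ (polyAt x (innerDiff g (h 0))) = 0 ∧ ∀ k ≤ m,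
      biharmonicCoeff ℝ n (ε + 2 * (k + 1) + 1) •
          lap (gram g x)⁻¹ (polyAt x (innerDiff g (h (k + 1)))) =
        -polyAt x (innerDiff g (metricHorner g h k)) := by
  have : NeZero n := ⟨hn⟩
  have innerDiff_smooth (k : ℕ) := (hh k).smoothSymmetric
  have hornerSum_eq_zero :
      hornerSum (quad (gram g x)) (fun k => polyAt x (innerDiff g (h k))) m = 0 := by
    rw [← polyAt_innerDiff_metricHorner g innerDiff_smooth, hd, map_zero]
  have last_eq_zero : lap (gram g x)⁻¹ (polyAt x (innerDiff g (h (m + 1)))) = 0 := by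
    rw [hm, innerDiff_zero, map_zero, map_zero]
  simpa only [Fintype.card_fin, polyAt_innerDiff_metricHorner g innerDiff_smooth] using
    lap_inv_eq_of_hornerSum_eq_zero (R := ℝ) (d := fun k => ε + 2 * k + 1) (gram_isSymm g x)
      (isUnit_gram g x) (fun k => by ring) (fun k => polyAt_isHomogeneous (innerDiff g (h k)) x)
      (fun k => lap_lap_polyAt_innerDiff g (hh k).smoothSymmetric (hh k).traceFree x)
      hornerSum_eq_zero last_eq_zero

theorem isPotential_divergence_of_metricHorner {h : ∀ k : ℕ, TensorField 𝕜 n M (ε + 2 * k)}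
    (hh : ∀ k, IsHarmonicField g (h k)) (hm : h (m + 1) = 0)
    (hd : innerDiff g (metricHorner g h m) = 0) (hn : n ≠ 0) {k : ℕ}
    (hk : k ≤ m) :
    IsPotential g (divergence g (h k)) := by
  cases k with
  | zero =>
    rw [divergence_eq_zero_of_lap (hh 0)
      fun x => (lap_polyAt_innerDiff_of_metricHorner hh hm hd hn x).1]
    exact isPotential_zero
  | succ k =>
    have v_smooth := isSmoothSymmetric_metricHorner g (fun k => (hh k).smoothSymmetric) k
    exact ⟨_, v_smooth.smul _, trace_covDeriv_eq_innerDiff (hh (k + 1)) v_smooth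
      (biharmonicCoeff_ne_zero hn _) fun x =>
        (lap_polyAt_innerDiff_of_metricHorner hh hm hd hn x).2 k (Nat.le_of_succ_le hk)⟩

theorem IsHarmonicExpansion.isPotential_divergence {f : TensorField 𝕜 n M (ε + 2 * m)}
    {h : ∀ k : Fin (m + 1), TensorField 𝕜 n M (ε + 2 * (k : ℕ))} (hh : IsHarmonicExpansion g f h)
    (hf : innerDiff g f = 0) (k : Fin (m + 1)) : IsPotential g (divergence g (h k)) := by
  rcases eq_or_ne n 0 with hn | hn
  · rw [divergence_eq_zero_of_dim_zero hn]
    exact isPotential_zero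
  · obtain ⟨h', h'_harmonic, h'_eq, h'_last, rfl⟩ := hh.exists_metricHorner_eq
    rw [← h'_eq]
    exact isPotential_divergence_of_metricHorner h'_harmonic h'_last hf hn
      (Nat.le_of_lt_succ k.isLt)

end Divergences

end KillingTensor

end

theorem mainTheorem12 {𝕜 : Type*} [RCLike 𝕜] {n : ℕ} {M : Type*} [TopologicalSpace M]
    [ChartedSpace (EuclideanSpace ℝ (Fin n)) M] [IsManifold (𝓡 n) ∞ M]
    (g : Bundle.ContMDiffRiemannianMetric (𝓡 n) ∞ (EuclideanSpace ℝ (Fin n))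
      (fun x : M => TangentSpace (𝓡 n) x))
    (ε m : ℕ) (hε : ε = 0 ∨ ε = 1)
    (f : KillingTensor.TensorField 𝕜 n M (ε + 2 * m)) (hf : KillingTensor.IsKilling g f) :
    (∃ h : ∀ k : Fin (m + 1), KillingTensor.TensorField 𝕜 n M (ε + 2 * (k : ℕ)),
      KillingTensor.IsHarmonicExpansion g f h) ∧
    ∀ h : ∀ k : Fin (m + 1), KillingTensor.TensorField 𝕜 n M (ε + 2 * (k : ℕ)),
      KillingTensor.IsHarmonicExpansion g f h →
        ∀ k : Fin (m + 1), KillingTensor.IsPotential g (KillingTensor.divergence g (h k)) :=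
  ⟨KillingTensor.exists_isHarmonicExpansion g hε hf.smoothSymmetric,
    fun _ hh => hh.isPotential_divergence hf.innerDiff_eq_zero⟩
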